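/- For $n,j,k\in\mathbb{N}$ with $k\le n+j$ let $S_{njk,n+j-k}=\min\{n,j,k,n+j-k\}+1$. For complex sequences $\alpha=(\alpha_n)_{n\ge 0}$ with $\sum_n (n+1)^2|\alpha_n|^2<\infty$ put $$Q(\alpha)=\sum_{n}(n+1)|\alpha_n|^2,\qquad E(\alpha)=\sum_n (n+1)^2|\alpha_n|^2,\qquad H(\alpha)=\sum_{n,j\ge 0}\sum_{k=0}^{n+j}S_{njk,n+j-k}\,\bar\alpha_n\bar\alpha_j\alpha_k\alpha_{n+j-k}.$$ A real stationary state with parameters $(\lambda,\omega)\in\mathbb{R}^2$ is a real sequence $A$ with $E(A)<\infty$ and $$(n+1)(\lambda-n\omega)A_n=\sum_{j\ge0}\sum_{k=0}^{n+j}S_{njk,n+j-k}A_jA_kA_{n+j-k}\qquad\text{for all } n\ge 0.$$ Write $e_i=(\delta_{ni})_{n\ge 0}$. For $\omega_*\in\mathbb{R}$ and a real sequence $v$, a branch bifurcating from the second eigenmode $e_1$ at $\omega_*$ in the direction $v$ is a pair of smooth maps $\epsilon\mapsto\omega(\epsilon)\in\mathbb{R}$, $\epsilon\mapsto A(\epsilon)\in\ell^2(\mathbb{N})$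 on some interval $(-r,r)$ with $r>0$, such that each $A(\epsilon)$ is a real stationary state with parameters $(\lambda,\omega)=(1+\omega(\epsilon),\omega(\epsilon))$ and, for some constant $C$, $$|\omega(\epsilon)-\omega_*|+\sup_n|A_n(\epsilon)-\delta_{n1}-\epsilon v_n|\le C\epsilon^2\qquad\text{for } |\epsilon|<r.$$ At a real stationary state $A$ with parameters $(\lambda,\omega)$ define the operators $$(L_\pm a)_n=\sum_{j\ge0}\sum_{k=0}^{n+j}S_{njk,n+j-k}\left[2A_jA_{n+j-k}a_k\pm A_kA_{n+j-k}a_j\right]-(n+1)(\lambda-n\omega)a_n$$ on their maximal domains in the real space $\ell^2(\mathbb{N})$. Let $n(L_-)$ be the number of negative eigenvalues of $L_-$, counted with multiplicity. With $M=\mathrm{diag}(1,2,3,\dots)$, let $n_c(L_+)$ be the number of negative eigenvalues, counted with multiplicity, of $L_+$ constrained in $W=\{a\in\ell^2(\mathbb{N}):\langle MA,a\rangle=\langle M^2A,a\rangle=0\}$, that is, of $P_WL_+$ acting in $W$, where $P_W$ is the orthogonal projection onto $W$. **Lemma.** Let $(\omega_*,v)$ be either $(\omega_2,\,3e_0-e_2)$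 with $\omega_2=2/3$, or $(\omega_6,\,e_6)$ with $\omega_6=3/35$. Then a branch bifurcating from $e_1$ at $\omega_*$ in the direction $v$ exists. Moreover, for every such branch there is $\epsilon_0>0$ such that, for all $\epsilon$ with $0<|\epsilon|<\epsilon_0$, the state $A(\epsilon)$ is a local minimizer of $H$ subject to fixed $Q$ and $E$ (that is, $H(\alpha)\ge H(A(\epsilon))$ for all complex sequences $\alpha$ with $E(\alpha)<\infty$, $Q(\alpha)=Q(A(\epsilon))$ and $E(\alpha)=E(A(\epsilon))$ that are sufficiently close to $A(\epsilon)$ in $\ell^2$), and $n_c(L_+)=0$ and $n(L_-)=0$ at $A(\epsilon)$. -/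

import Mathlib

open scoped ContDiff InnerProductSpace

noncomputable section

namespace ConformalFlow

/-- The real Hilbert space `ℓ²(ℕ)`. -/
abbrev RealSeq : Type := lp (fun _ : ℕ => ℝ) 2

/-- The complex Hilbert space `ℓ²(ℕ)`, in which the amplitudes live. -/
abbrev ComplexSeq : Type := lp (fun _ : ℕ => ℂ) 2

/-- The interaction coefficient `S_{n j k, n+j-k} = min(n, j, k, n+j-k) + 1`
(used only for `k ≤ n + j`). -/
def S (n j k : ℕ) : ℝ := ((min (min n j) (min k (n + j - k)) + 1 : ℕ) : ℝ)

/-! ### Conserved quantities -/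

/-- Sequences for which `E` (hence also `Q` and `H`) is given by a convergent series. -/
def FiniteEnergy (α : ℕ → ℂ) : Prop :=
  Summable fun n : ℕ => ((n : ℝ) + 1) ^ 2 * ‖α n‖ ^ 2

/-- `Q(α) = ∑ (n+1) |α_n|²`. -/
def Q (α : ℕ → ℂ) : ℝ := ∑' n : ℕ, ((n : ℝ) + 1) * ‖α n‖ ^ 2

/-- `E(α) = ∑ (n+1)² |α_n|²`. -/
def E (α : ℕ → ℂ) : ℝ := ∑' n : ℕ, ((n : ℝ) + 1) ^ 2 * ‖α n‖ ^ 2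

/-- `H(α) = ∑_n ∑_j ∑_{k ≤ n+j} S_{n j k, n+j-k} conj(α_n) conj(α_j) α_k α_{n+j-k}`.
The sum is real, since exchanging `(n, j)` with `(k, n+j-k)` conjugates it; taking the
real part only makes `H` a real-valued function. -/
def H (α : ℕ → ℂ) : ℝ :=
  (∑' n : ℕ, ∑' j : ℕ, ∑ k ∈ Finset.range (n + j + 1),
    (S n j k : ℂ) * (starRingEnd ℂ (α n) * starRingEnd ℂ (α j) * α k * α (n + j - k))).re

/-- A real square-summable sequence, regarded as a complex one. -/
def toComplex (A : RealSeq) : ComplexSeq :=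
  ⟨fun n => ((A n : ℝ) : ℂ), by
    refine (memℓp_gen_iff (by norm_num)).2 ?_
    have h := (memℓp_gen_iff (p := 2) (by norm_num)).1 (lp.memℓp A)
    simpa using h⟩

/-- `A` is a local minimizer of `H` subject to fixed `Q` and `E`: it minimizes `H` among all
complex sequences of finite energy with the same `Q` and `E` which are close to `A` in `ℓ²`. -/
def IsConstrainedLocalMin (A : RealSeq) : Prop :=
  IsLocalMinOn (fun α : ComplexSeq => H α)
    {α : ComplexSeq | FiniteEnergy α ∧ Q α = Q (toComplex A) ∧ E α = E (toComplex A)}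
    (toComplex A)

/-! ### Real stationary states and branches -/

/-- `A` is a real stationary state of finite energy with parameters `(lam, om)`:
`(n+1) (lam - n om) A_n = ∑_j ∑_{k ≤ n+j} S_{n j k, n+j-k} A_j A_k A_{n+j-k}` for all `n`.
Finite energy makes the series over `j` absolutely convergent. -/
def IsStationary (lam om : ℝ) (A : RealSeq) : Prop :=
  FiniteEnergy (toComplex A) ∧
  ∀ n : ℕ, ((n : ℝ) + 1) * (lam - n * om) * A n =
    ∑' j : ℕ, ∑ k ∈ Finset.range (n + j + 1), S n j k * (A j * A k * A (n + j - k))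

/-- The unit sequence `e_i`, with entries `δ_{n i}`. -/
def unitSeq (i : ℕ) : ℕ → ℝ := Pi.single i 1

/-- `(om, A)`, parameterized by `ε ∈ (-r, r)`, is a smooth branch of real stationary states
with `lam - om = 1` that bifurcates from the second eigenmode `e_1` at `omStar`
in the direction `v`:
`|om(ε) - omStar| + sup_n |A_n(ε) - δ_{n 1} - ε v_n| ≤ C ε²`. -/
structure IsBranch (omStar : ℝ) (v : ℕ → ℝ) (r : ℝ) (om : ℝ → ℝ) (A : ℝ → RealSeq) :
    Prop where
  pos : 0 < r
  smooth_om : ContDiffOn ℝ ∞ om (Set.Ioo (-r) r)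
  smooth_A : ContDiffOn ℝ ∞ A (Set.Ioo (-r) r)
  stationary : ∀ ε ∈ Set.Ioo (-r) r, IsStationary (1 + om ε) (om ε) (A ε)
  bound : ∃ C : ℝ, ∀ ε ∈ Set.Ioo (-r) r, ∀ n : ℕ,
    |om ε - omStar| + |A ε n - unitSeq 1 n - ε * v n| ≤ C * ε ^ 2

/-! ### The Hessian operators -/

/-- The `j`-th term of the series in the definition of `L_±`, where `s = ±1`. -/
def hessTerm (s : ℝ) (A a : ℕ → ℝ) (n j : ℕ) : ℝ :=
  ∑ k ∈ Finset.range (n + j + 1),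
    S n j k * (2 * A j * A (n + j - k) * a k + s * (A k * A (n + j - k) * a j))

/-- The sequence `L_± a`, where `s = ±1`. -/
def hessSeq (s lam om : ℝ) (A a : ℕ → ℝ) (n : ℕ) : ℝ :=
  (∑' j : ℕ, hessTerm s A a n j) - ((n : ℝ) + 1) * (lam - n * om) * a n

theorem hessTerm_add (s : ℝ) (A a b : ℕ → ℝ) (n j : ℕ) :
    hessTerm s A (a + b) n j = hessTerm s A a n j + hessTerm s A b n j := by
  simp only [hessTerm, ← Finset.sum_add_distrib, Pi.add_apply]
  exact Finset.sum_congr rfl fun k _ => by ring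

theorem hessTerm_smul (s : ℝ) (A : ℕ → ℝ) (c : ℝ) (a : ℕ → ℝ) (n j : ℕ) :
    hessTerm s A (c • a) n j = c * hessTerm s A a n j := by
  simp only [hessTerm, Finset.mul_sum, Pi.smul_apply, smul_eq_mul]
  exact Finset.sum_congr rfl fun k _ => by ring

theorem hessSeq_add (s lam om : ℝ) (A a b : ℕ → ℝ)
    (ha : ∀ n, Summable (hessTerm s A a n)) (hb : ∀ n, Summable (hessTerm s A b n)) :
    hessSeq s lam om A (a + b) = hessSeq s lam om A a + hessSeq s lam om A b := by
  funext n
  simp only [hessSeq, hessTerm_add, Pi.add_apply]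
  rw [(ha n).tsum_add (hb n)]
  ring

theorem hessSeq_smul (s lam om : ℝ) (A : ℕ → ℝ) (c : ℝ) (a : ℕ → ℝ) :
    hessSeq s lam om A (c • a) = c • hessSeq s lam om A a := by
  funext n
  simp only [hessSeq, hessTerm_smul, Pi.smul_apply, smul_eq_mul, tsum_mul_left]
  ring

/-- The unbounded operator `L_±` (for `s = ±1`) on its maximal domain in `ℓ²(ℕ)`, that is,
on all `a ∈ ℓ²(ℕ)` for which `L_± a` is defined and lies in `ℓ²(ℕ)`. -/
def hessOp (s lam om : ℝ) (A : RealSeq) : RealSeq →ₗ.[ℝ] RealSeq where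
  domain :=
    { carrier := {a | (∀ n, Summable (hessTerm s A a n)) ∧ Memℓp (hessSeq s lam om A a) 2}
      zero_mem' := by
        have h0 : ∀ n j, hessTerm s A (⇑(0 : RealSeq)) n j = 0 := fun n j => by
          simp [hessTerm]
        refine ⟨fun n => ?_, ?_⟩
        · rw [show hessTerm s A (⇑(0 : RealSeq)) n = 0 from funext (h0 n)]
          exact summable_zero
        · rw [show hessSeq s lam om A (⇑(0 : RealSeq)) = 0 from
            funext fun n => by
              simp only [hessSeq, h0, tsum_zero]
              simp]
          exact zero_memℓp
      add_mem' := by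
        rintro a b ⟨ha, ha'⟩ ⟨hb, hb'⟩
        refine ⟨fun n => ?_, ?_⟩
        · rw [lp.coeFn_add, show hessTerm s A (⇑a + ⇑b) n = fun j =>
            hessTerm s A a n j + hessTerm s A b n j from funext (hessTerm_add s A a b n)]
          exact (ha n).add (hb n)
        · rw [lp.coeFn_add, hessSeq_add s lam om A a b ha hb]
          exact ha'.add hb'
      smul_mem' := by
        rintro c a ⟨ha, ha'⟩
        refine ⟨fun n => ?_, ?_⟩
        · rw [lp.coeFn_smul, show hessTerm s A (c • ⇑a) n = fun j =>
            c * hessTerm s A a n j from funext (hessTerm_smul s A c a n)]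
          exact (ha n).mul_left c
        · rw [lp.coeFn_smul, hessSeq_smul]
          exact ha'.const_smul c }
  toFun :=
    { toFun := fun a => ⟨hessSeq s lam om A (a : RealSeq), a.2.2⟩
      map_add' := fun a b => Subtype.ext (hessSeq_add s lam om A _ _ a.2.1 b.2.1)
      map_smul' := fun c a => Subtype.ext (hessSeq_smul s lam om A c _) }

/-- The operator `L_+` at the state `A` with parameters `(lam, om)`. -/
def LPlus (lam om : ℝ) (A : RealSeq) : RealSeq →ₗ.[ℝ] RealSeq := hessOp 1 lam om A

/-- The operator `L_-` at the state `A` with parameters `(lam, om)`. -/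
def LMinus (lam om : ℝ) (A : RealSeq) : RealSeq →ₗ.[ℝ] RealSeq := hessOp (-1) lam om A

/-! ### Negative eigenvalues, with and without constraints -/

/-- The eigenspace, for the value `μ`, of the operator `T` in the Hilbert space. -/
def eigenspace (T : RealSeq →ₗ.[ℝ] RealSeq) (μ : ℝ) : Submodule ℝ RealSeq :=
  (LinearMap.ker (T.toFun - μ • T.domain.subtype)).map T.domain.subtype

/-- The eigenspace, for the value `μ`, of the operator `T` constrained in `W`, that is, of
`P T` on `W ∩ D(T)`, where `P` is the orthogonal projection onto `W`:
`a ∈ W ∩ D(T)` with `T a - μ a ⊥ W`. -/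
def constrainedEigenspace (T : RealSeq →ₗ.[ℝ] RealSeq) (W : Submodule ℝ RealSeq) (μ : ℝ) :
    Submodule ℝ RealSeq :=
  ((Wᗮ).comap (T.toFun - μ • T.domain.subtype)).map T.domain.subtype ⊓ W

/-- The number of negative eigenvalues of `T`, counted with their multiplicities. -/
def numNeg (T : RealSeq →ₗ.[ℝ] RealSeq) : Cardinal :=
  Cardinal.sum fun μ : Set.Iio (0 : ℝ) => Module.rank ℝ (eigenspace T μ)

/-- The number of negative eigenvalues of `T` constrained in `W`, counted with their
multiplicities. -/
def numNegConstrained (T : RealSeq →ₗ.[ℝ] RealSeq) (W : Submodule ℝ RealSeq) : Cardinal :=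
  Cardinal.sum fun μ : Set.Iio (0 : ℝ) => Module.rank ℝ (constrainedEigenspace T W μ)

/-- The sequences `a ∈ ℓ²(ℕ)` with `∑ w_n a_n = 0`. For `w ∈ ℓ²(ℕ)` the series always
converges, and this is the orthogonal complement of `w`. -/
def annihilator (w : ℕ → ℝ) : Submodule ℝ RealSeq where
  carrier := {a | HasSum (fun n => w n * a n) 0}
  zero_mem' := by simp
  add_mem' := by
    intro a b ha hb
    simpa [mul_add] using HasSum.add ha hb
  smul_mem' := by
    intro c a ha
    simpa [mul_left_comm] using HasSum.mul_left c ha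

/-- The constrained space `{a ∈ ℓ²(ℕ) : ⟨M A, a⟩ = ⟨M² A, a⟩ = 0}` with
`M = diag(1, 2, 3, …)`. -/
def constrainedSpace (A : RealSeq) : Submodule ℝ RealSeq :=
  annihilator (fun n => ((n : ℝ) + 1) * A n) ⊓
    annihilator (fun n => ((n : ℝ) + 1) ^ 2 * A n)

/-- The variational characterization of a branch: for every small `ε ≠ 0`, the state `A(ε)`
is a local minimizer of `H` subject to fixed `Q` and `E`, with `n_c(L_+) = 0` and
`n(L_-) = 0`. -/
def IsMinimizingBranch (om : ℝ → ℝ) (A : ℝ → RealSeq) : Prop :=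
  ∃ ε₀ > 0, ∀ ε : ℝ, 0 < |ε| → |ε| < ε₀ →
    IsConstrainedLocalMin (A ε) ∧
    numNegConstrained (LPlus (1 + om ε) (om ε) (A ε)) (constrainedSpace (A ε)) = 0 ∧
    numNeg (LMinus (1 + om ε) (om ε) (A ε)) = 0

end ConformalFlow

end

noncomputable section

namespace ConformalFlow

/-! ### Generalities on `ℓ²` -/

/-! The weight `S n j k` counts the integers `p ≥ 0` that lie below all four indices `n`, `j`, `k`,
`n+j-k`. Hence `H(α)` is the sum over `(p, q)` of `|∑_{i+i'=q} α_{p+i} α_{p+i'}|²`, that is, the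
squared norm of a quadratic map. In the energy coordinates `x_n = (n+1) A_n`, so that `A = shrink x`
and `E = ‖x‖²`, the underlying bilinear map `cone` is bounded into `ℓ²(ℕ × ℕ)`. Everything becomes
calculus for polynomials on a Hilbert space: stationary states are the critical points of `H/2 -
(1+2ω)Q + ωE`, and `L_±` are represented by bounded forms `hessForm (±1)`.

At `e_1` these forms are diagonal apart from a coupling of modes `0` and `2`. At each of the two
frequencies `L_+` has the one-dimensional kernel spanned by `v` and is otherwise positive, while
`L_-` is nonnegative with kernel spanned by `e_1` and `(M-2)v`. `IsBifurcation` records these facts,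
with `disp v` and `dispMinus v` detecting the critical directions.

Existence: `e_1` is stationary for every `ω`, so putting `A = e_1 + ε z` allows a factor `ε` to be
divided out of the equation. The implicit function theorem solves the quotient for `(z, ω)`; its
linearization is invertible by Lax–Milgram and `disp v v ≠ 0`. A parity cancellation in the cubic
term gives `ω - ω_* = O(ε²)`.

Minimality: the stationary equation forces uniform polynomial decay, which upgrades the sup-norm
expansion of an arbitrary branch to `(x(ε) - e_1)/ε → v` in the energy norm
(`IsBranch.exists_lift`). As `M - 2` annihilates `e_1`, the constraint vectors of `L_+` combine to
`(M²A - 2MA)/ε → M(M-2)v`, which does not vanish on `v`; likewise the vectors `A` and `(MA - 2A)/ε`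
tend to `e_1` and `(M-2)v`, which span the kernel of `L_-`. So for small `ε ≠ 0` both forms are
coercive modulo their constraints (`IsBifurcation.eventually_plus`,
`IsBifurcation.eventually_minus`).

Coercivity of `L_+` gives `n_c(L_+) = 0`. On the branch `A` and `MA`, the generators of the two
phase rotations, lie in the kernel of `L_-`, so eigenvectors with negative eigenvalue are orthogonal
to them and `n(L_-) = 0`. A competitor is first rotated so that its imaginary part is orthogonal to
`A` and `MA`; after that the second-order expansion of `H` on the constraint set is positive and
dominates the cubic remainder. -/

theorem memlp_two_iff {ι : Type*} {f : ι → ℝ} :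
    Memℓp f 2 ↔ Summable fun i => f i ^ 2 := by
  rw [memℓp_gen_iff (by norm_num)]
  simp

theorem hasSum_sq {ι : Type*} (x : lp (fun _ : ι => ℝ) 2) :
    HasSum (fun i => x i ^ 2) (‖x‖ ^ 2) := by
  have h := lp.hasSum_inner (𝕜 := ℝ) x x
  rw [real_inner_self_eq_norm_sq] at h
  simpa [sq] using h

theorem hasSum_mul {ι : Type*} (x y : lp (fun _ : ι => ℝ) 2) :
    HasSum (fun i => x i * y i) ⟪x, y⟫_ℝ := by
  have h := lp.hasSum_inner (𝕜 := ℝ) x y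
  simpa [mul_comm] using h

theorem summable_inv_sq : Summable fun n : ℕ => (1 : ℝ) / ((n : ℝ) + 1) ^ 2 := by
  have h := (summable_nat_add_iff (f := fun n : ℕ => (1 : ℝ) / (n : ℝ) ^ 2) 1).2
    (Real.summable_one_div_nat_pow.2 one_lt_two)
  simpa using h

/-! ### Convolution on the cone -/

/-- The amplitudes `a_n = x_n / (n + 1)` whose energy is `‖x‖²`. -/
def amp (x : RealSeq) (n : ℕ) : ℝ := x n / ((n : ℝ) + 1)

theorem amp_add (x y : RealSeq) (n : ℕ) : amp (x + y) n = amp x n + amp y n := by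
  simp [amp, add_div]

theorem amp_smul (c : ℝ) (x : RealSeq) (n : ℕ) : amp (c • x) n = c * amp x n := by
  simp [amp, mul_div_assoc]

theorem mul_amp (x : RealSeq) (n : ℕ) : ((n : ℝ) + 1) * amp x n = x n := by
  have : (n : ℝ) + 1 ≠ 0 := by positivity
  simp [amp]; field_simp

/-- The sum of `a_n b_j` over all `n, j ≥ p` with `n + j = 2p + q`. -/
def conv (a b : ℕ → ℝ) (z : ℕ × ℕ) : ℝ :=
  ∑ i ∈ Finset.HasAntidiagonal.antidiagonal z.2, a (z.1 + i.1) * b (z.1 + i.2)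

theorem conv_comm (a b : ℕ → ℝ) (z : ℕ × ℕ) : conv a b z = conv b a z := by
  unfold conv
  rw [← Finset.Nat.sum_antidiagonal_swap]
  exact Finset.sum_congr rfl fun i _ => by simp [mul_comm]

/-- Reindexing of `(p, i, i')` by `(p, i + i')` and a point of the antidiagonal. -/
def antidiagonalSigmaEquiv :
    (Σ z : ℕ × ℕ, Finset.HasAntidiagonal.antidiagonal z.2) ≃ ℕ × (ℕ × ℕ) where
  toFun s := (s.1.1, s.2.1)
  invFun t := ⟨(t.1, t.2.1 + t.2.2), ⟨t.2, by simp⟩⟩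
  left_inv := by
    rintro ⟨⟨p, q⟩, ⟨⟨i, j⟩, h⟩⟩
    simp only [Finset.HasAntidiagonal.mem_antidiagonal] at h
    subst h
    rfl
  right_inv _ := rfl

theorem hasSum_antidiagonal {f : ℕ × (ℕ × ℕ) → ℝ} {s : ℝ} (h : HasSum f s) :
    HasSum (fun z : ℕ × ℕ => ∑ i ∈ Finset.HasAntidiagonal.antidiagonal z.2, f (z.1, i)) s := by
  have h1 := (antidiagonalSigmaEquiv.hasSum_iff (f := f)).2 h
  refine h1.sigma fun z => ?_
  have := hasSum_fintype fun i : Finset.HasAntidiagonal.antidiagonal z.2 => f (z.1, i)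
  rw [← Finset.sum_coe_sort (Finset.HasAntidiagonal.antidiagonal z.2) (fun i => f (z.1, i))]
  exact this

theorem summable_of_antidiagonal {f : ℕ × (ℕ × ℕ) → ℝ} (h0 : ∀ t, 0 ≤ f t)
    (h : Summable fun z : ℕ × ℕ => ∑ i ∈ Finset.HasAntidiagonal.antidiagonal z.2, f (z.1, i)) :
    Summable f := by
  rw [← antidiagonalSigmaEquiv.summable_iff]
  refine (summable_sigma_of_nonneg fun _ => h0 _).2 ⟨fun z => Summable.of_finite, ?_⟩
  refine h.congr fun z => ?_
  rw [tsum_fintype, ← Finset.sum_coe_sort (Finset.HasAntidiagonal.antidiagonal z.2) (fun i => f (z.1, i))]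
  rfl

theorem summable_triple (x y : RealSeq) :
    Summable (fun t : ℕ × (ℕ × ℕ) => 1 / ((t.1 : ℝ) + 1) ^ 2 * (x t.2.1 ^ 2 * y t.2.2 ^ 2)) := by
  have h := (hasSum_sq x).summable.mul_of_nonneg (hasSum_sq y).summable
    (fun _ => sq_nonneg _) (fun _ => sq_nonneg _)
  exact summable_inv_sq.mul_of_nonneg h (fun _ => by simp only [Pi.zero_apply]; positivity)
    (fun _ => by simp only [Pi.zero_apply]; positivity)

theorem tsum_triple (x y : RealSeq) :
    ∑' t : ℕ × (ℕ × ℕ), 1 / ((t.1 : ℝ) + 1) ^ 2 * (x t.2.1 ^ 2 * y t.2.2 ^ 2) =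
      (∑' n : ℕ, 1 / ((n : ℝ) + 1) ^ 2) * (‖x‖ ^ 2 * ‖y‖ ^ 2) := by
  have h := (hasSum_sq x).summable.mul_of_nonneg (hasSum_sq y).summable
    (fun _ => sq_nonneg _) (fun _ => sq_nonneg _)
  have h1 := summable_inv_sq.tsum_mul_tsum h (summable_triple x y)
  rw [← h1, ← (hasSum_sq x).tsum_eq, ← (hasSum_sq y).tsum_eq,
    (hasSum_sq x).summable.tsum_mul_tsum (hasSum_sq y).summable h]

/-- The weighted square dominating `conv`. -/
theorem amp_sq_le (x y : RealSeq) (p i j : ℕ) :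
    ((i + j : ℕ) + 1 : ℝ) * (amp x (p + i) * amp y (p + j)) ^ 2 ≤
      1 / ((p : ℝ) + 1) ^ 2 * (x (p + i) ^ 2 * y (p + j) ^ 2) := by
  have e : (amp x (p + i) * amp y (p + j)) ^ 2 =
      (x (p + i) ^ 2 * y (p + j) ^ 2) / ((((p + i : ℕ) : ℝ) + 1) ^ 2 * (((p + j : ℕ) : ℝ) + 1) ^ 2) := by
    simp only [amp]; field_simp
  rw [e, mul_div_assoc', one_div_mul_eq_div]
  have hk : (0 : ℝ) ≤ x (p + i) ^ 2 * y (p + j) ^ 2 := by positivity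
  rw [div_le_div_iff₀ (by positivity) (by positivity), mul_comm _ (x (p + i) ^ 2 * y (p + j) ^ 2),
    mul_assoc]
  refine mul_le_mul_of_nonneg_left ?_ hk
  push_cast
  have hp : (0 : ℝ) ≤ p := by positivity
  have hi : (0 : ℝ) ≤ i := by positivity
  have hj : (0 : ℝ) ≤ j := by positivity
  have h1 : (i + j + 1 : ℝ) ≤ (p + i + 1) * (p + j + 1) := by nlinarith [mul_nonneg hi hj, mul_nonneg hp hi, mul_nonneg hp hj]
  have h2 : ((p : ℝ) + 1) ^ 2 ≤ (p + i + 1) * (p + j + 1) := by nlinarith [mul_nonneg hi hj, mul_nonneg hp hi, mul_nonneg hp hj]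
  calc (i + j + 1 : ℝ) * (p + 1) ^ 2 ≤ ((p + i + 1) * (p + j + 1)) * ((p + i + 1) * (p + j + 1)) := by
        gcongr
    _ = _ := by ring

/-- The bound of `amp_sq_le` leaves a factor `1/(p+1)²`, summable in `p`, times a product whose
indices run injectively through pairs. -/
theorem summable_amp_sq (x y : RealSeq) :
    Summable (fun t : ℕ × (ℕ × ℕ) =>
      ((t.2.1 + t.2.2 : ℕ) + 1 : ℝ) * (amp x (t.1 + t.2.1) * amp y (t.1 + t.2.2)) ^ 2) ∧
    ∑' t : ℕ × (ℕ × ℕ),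
      ((t.2.1 + t.2.2 : ℕ) + 1 : ℝ) * (amp x (t.1 + t.2.1) * amp y (t.1 + t.2.2)) ^ 2 ≤
      (∑' n : ℕ, 1 / ((n : ℝ) + 1) ^ 2) * (‖x‖ ^ 2 * ‖y‖ ^ 2) := by
  let sh : ℕ × (ℕ × ℕ) → ℕ × (ℕ × ℕ) := fun t => (t.1, (t.1 + t.2.1, t.1 + t.2.2))
  have hinj : Function.Injective sh := by
    rintro ⟨p, i, j⟩ ⟨p', i', j'⟩ h
    simp only [sh, Prod.mk.injEq] at h ⊢
    omega
  have hs := (summable_triple x y).comp_injective hinj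
  have hle : ∀ t : ℕ × (ℕ × ℕ), ((t.2.1 + t.2.2 : ℕ) + 1 : ℝ) *
      (amp x (t.1 + t.2.1) * amp y (t.1 + t.2.2)) ^ 2 ≤
      ((fun t : ℕ × (ℕ × ℕ) => 1 / ((t.1 : ℝ) + 1) ^ 2 * (x t.2.1 ^ 2 * y t.2.2 ^ 2)) ∘ sh) t :=
    fun t => amp_sq_le x y t.1 t.2.1 t.2.2
  have hsum := Summable.of_nonneg_of_le (fun t => by positivity) hle hs
  refine ⟨hsum, (hsum.tsum_le_tsum hle hs).trans ?_⟩
  rw [← tsum_triple]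
  exact tsum_comp_le_tsum_of_inj (summable_triple x y) (fun t => by positivity) hinj

/-- Cauchy–Schwarz on the antidiagonal, which has `q + 1` points; this is the source of the weight
in `amp_sq_le`. -/
theorem conv_sq_le (x y : RealSeq) (z : ℕ × ℕ) :
    conv (amp x) (amp y) z ^ 2 ≤ ∑ i ∈ Finset.HasAntidiagonal.antidiagonal z.2,
      ((i.1 + i.2 : ℕ) + 1 : ℝ) * (amp x (z.1 + i.1) * amp y (z.1 + i.2)) ^ 2 := by
  refine sq_sum_le_card_mul_sum_sq.trans ?_
  rw [Finset.mul_sum]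
  refine (Finset.sum_congr rfl fun i hi => ?_).le
  rw [Finset.Nat.card_antidiagonal, Finset.HasAntidiagonal.mem_antidiagonal.1 hi]
  push_cast; ring

theorem summable_conv_sq (x y : RealSeq) :
    Summable (fun z => conv (amp x) (amp y) z ^ 2) ∧
      ∑' z, conv (amp x) (amp y) z ^ 2 ≤
        (∑' n : ℕ, 1 / ((n : ℝ) + 1) ^ 2) * (‖x‖ ^ 2 * ‖y‖ ^ 2) := by
  have h := hasSum_antidiagonal (summable_amp_sq x y).1.hasSum
  have hs := Summable.of_nonneg_of_le (fun _ => sq_nonneg _) (conv_sq_le x y) h.summable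
  exact ⟨hs, (hs.tsum_le_tsum (conv_sq_le x y) h.summable).trans
    (h.tsum_eq.trans_le (summable_amp_sq x y).2)⟩

/-- The space in which the convolution takes its values. -/
abbrev ConeSeq : Type := lp (fun _ : ℕ × ℕ => ℝ) 2

/-- The convolution of amplitudes, as a bounded bilinear map. -/
def cone : RealSeq →L[ℝ] RealSeq →L[ℝ] ConeSeq :=
  LinearMap.mkContinuous₂
    (LinearMap.mk₂ ℝ (fun x y => (⟨conv (amp x) (amp y), memlp_two_iff.2 (summable_conv_sq x y).1⟩ : ConeSeq))
      (fun x x' y => by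
        ext z
        change conv _ _ z = conv _ _ z + conv _ _ z
        simp [conv, amp_add, add_mul, Finset.sum_add_distrib])
      (fun c x y => by
        ext z
        simp [conv, amp_smul, Finset.mul_sum, mul_assoc])
      (fun x y y' => by
        ext z
        change conv _ _ z = conv _ _ z + conv _ _ z
        simp [conv, amp_add, mul_add, Finset.sum_add_distrib])
      (fun c x y => by
        ext z
        simp only [conv, amp_smul, lp.coeFn_smul, Pi.smul_apply, smul_eq_mul, Finset.mul_sum]
        exact Finset.sum_congr rfl fun i _ => by ring))
    (Real.sqrt (∑' n : ℕ, 1 / ((n : ℝ) + 1) ^ 2))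
    (fun x y => by
      refine abs_le_of_sq_le_sq' ?_ (by positivity) |>.2
      rw [mul_pow, mul_pow, Real.sq_sqrt (tsum_nonneg fun _ => by positivity), mul_assoc,
        ← (hasSum_sq _).tsum_eq]
      exact (summable_conv_sq x y).2)

theorem cone_apply (x y : RealSeq) (z : ℕ × ℕ) : cone x y z = conv (amp x) (amp y) z := rfl

theorem cone_comm (x y : RealSeq) : cone x y = cone y x := by
  ext z
  simp only [cone_apply, conv_comm]

/-! ### The quartic form -/

theorem conv_zero_snd (c d : ℕ → ℝ) {n j p : ℕ} (hn : p ≤ n) (hj : p ≤ j) :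
    conv c d (p, (n - p) + (j - p)) = ∑ k ∈ Finset.range (n + j + 1),
      if p ≤ k ∧ p ≤ n + j - k then c k * d (n + j - k) else 0 := by
  rw [← Finset.sum_filter]
  refine Finset.sum_nbij' (fun i => p + i.1) (fun k => (k - p, n + j - k - p)) ?_ ?_ ?_ ?_ ?_
  · rintro ⟨i, i'⟩ h
    simp only [Finset.HasAntidiagonal.mem_antidiagonal, Finset.mem_filter, Finset.mem_range] at h ⊢
    omega
  · intro k h
    simp only [Finset.HasAntidiagonal.mem_antidiagonal, Finset.mem_filter, Finset.mem_range] at h ⊢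
    omega
  · rintro ⟨i, i'⟩ h
    simp only [Finset.HasAntidiagonal.mem_antidiagonal, Prod.mk.injEq] at h ⊢
    omega
  · intro k h
    simp only [Finset.mem_filter, Finset.mem_range] at h ⊢
    omega
  · rintro ⟨i, i'⟩ h
    simp only [Finset.HasAntidiagonal.mem_antidiagonal] at h ⊢
    congr 2
    omega

/-- Writing `S` as the number of `p` below all four indices and exchanging the sums over `k` and `p`
turns the weighted sum into unweighted convolutions. -/
theorem sum_S_mul (c d : ℕ → ℝ) (n j : ℕ) :
    ∑ k ∈ Finset.range (n + j + 1), S n j k * (c k * d (n + j - k)) =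
      ∑ p ∈ Finset.range (min n j + 1), conv c d (p, (n - p) + (j - p)) := by
  rw [Finset.sum_congr rfl fun p hp => conv_zero_snd c d (n := n) (j := j) (p := p)
    (by simp at hp; omega) (by simp at hp; omega), Finset.sum_comm]
  refine Finset.sum_congr rfl fun k _ => ?_
  rw [← Finset.sum_filter, Finset.sum_const, nsmul_eq_mul]
  congr 1
  have : (Finset.range (min n j + 1)).filter (fun p => p ≤ k ∧ p ≤ n + j - k) =
      Finset.range (min (min n j) (min k (n + j - k)) + 1) := by
    ext p
    simp only [Finset.mem_filter, Finset.mem_range]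
    omega
  rw [this, Finset.card_range, S]

/-- Reindexing of `(p, i, i')` by `(n, j) = (p + i, p + i')` and `p ≤ min n j`. -/
def minSigmaEquiv : (Σ z : ℕ × ℕ, Finset.range (min z.1 z.2 + 1)) ≃ ℕ × (ℕ × ℕ) where
  toFun s := (s.2.1, (s.1.1 - s.2.1, s.1.2 - s.2.1))
  invFun t := ⟨(t.1 + t.2.1, t.1 + t.2.2), ⟨t.1, by simp⟩⟩
  left_inv := by
    rintro ⟨⟨n, j⟩, ⟨p, h⟩⟩
    obtain ⟨i, rfl⟩ : ∃ i, n = p + i := Nat.exists_eq_add_of_le (by simp at h; omega)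
    obtain ⟨i', rfl⟩ : ∃ i, j = p + i := Nat.exists_eq_add_of_le (by simp at h; omega)
    have h1 : p + (p + i - p) = p + i := by omega
    have h2 : p + (p + i' - p) = p + i' := by omega
    simp only [Sigma.mk.injEq, h1, h2, true_and]
    congr!
  right_inv t := by simp

theorem hasSum_min {f : ℕ × (ℕ × ℕ) → ℝ} {s : ℝ} (h : HasSum f s) :
    HasSum (fun z : ℕ × ℕ => ∑ p ∈ Finset.range (min z.1 z.2 + 1), f (p, (z.1 - p, z.2 - p))) s := by
  have h1 := (minSigmaEquiv.hasSum_iff (f := f)).2 h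
  refine h1.sigma fun z => ?_
  have := hasSum_fintype fun p : Finset.range (min z.1 z.2 + 1) => f (p, (z.1 - p, z.2 - p))
  rw [← Finset.sum_coe_sort (Finset.range (min z.1 z.2 + 1)) (fun p => f (p, (z.1 - p, z.2 - p)))]
  exact this

/-- Young's inequality with weight `q + 1`: one half is `summable_amp_sq`, and in the other the `q +
1` equal terms on each antidiagonal restore `conv ^ 2`. This absolute convergence justifies the
rearrangements in `hasSum_quartic`. -/
theorem summable_conv_triple (x y u v : RealSeq) :
    Summable fun t : ℕ × (ℕ × ℕ) => amp x (t.1 + t.2.1) * amp y (t.1 + t.2.2) *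
      conv (amp u) (amp v) (t.1, t.2.1 + t.2.2) := by
  have h1 := (summable_amp_sq x y).1
  have h2 : Summable fun t : ℕ × (ℕ × ℕ) =>
      conv (amp u) (amp v) (t.1, t.2.1 + t.2.2) ^ 2 / ((t.2.1 + t.2.2 : ℕ) + 1 : ℝ) := by
    refine summable_of_antidiagonal (fun t => by positivity) ?_
    refine (summable_conv_sq u v).1.congr fun z => ?_
    rw [Finset.sum_congr rfl (g := fun _ => conv (amp u) (amp v) z ^ 2 / ((z.2 : ℕ) + 1 : ℝ))
      fun i hi => by rw [Finset.HasAntidiagonal.mem_antidiagonal.1 hi], Finset.sum_const,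
      Finset.Nat.card_antidiagonal, nsmul_eq_mul]
    have : (z.2 : ℝ) + 1 ≠ 0 := by positivity
    push_cast
    field_simp
  refine Summable.of_norm_bounded (h1.add h2) fun t => ?_
  set A := amp x (t.1 + t.2.1) * amp y (t.1 + t.2.2)
  set B := conv (amp u) (amp v) (t.1, t.2.1 + t.2.2)
  set w : ℝ := (t.2.1 + t.2.2 : ℕ) + 1
  have hw : 0 < w := by positivity
  have h3 : (w * |A| - |B|) ^ 2 / w = w * A ^ 2 + B ^ 2 / w - 2 * (|A| * |B|) := by
    rw [← sq_abs A, ← sq_abs B]; field_simp; ring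
  have h4 : 0 ≤ (w * |A| - |B|) ^ 2 / w := by positivity
  rw [Real.norm_eq_abs, abs_mul]
  nlinarith [mul_nonneg (abs_nonneg A) (abs_nonneg B)]

theorem hasSum_quartic (x y u v : RealSeq) :
    HasSum (fun z : ℕ × ℕ => amp x z.1 * amp y z.2 *
      ∑ k ∈ Finset.range (z.1 + z.2 + 1), S z.1 z.2 k * (amp u k * amp v (z.1 + z.2 - k)))
      ⟪cone x y, cone u v⟫_ℝ := by
  obtain ⟨s, hs⟩ := summable_conv_triple x y u v
  have h1 := hasSum_antidiagonal hs
  have h2 : s = ⟪cone x y, cone u v⟫_ℝ := by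
    refine h1.unique ?_
    convert hasSum_mul (cone x y) (cone u v) using 2 with z
    rw [cone_apply, cone_apply, conv, Finset.sum_mul]
    refine Finset.sum_congr rfl fun i hi => ?_
    rw [Finset.HasAntidiagonal.mem_antidiagonal.1 hi]
  rw [← h2]
  convert hasSum_min hs using 2 with z
  rw [sum_S_mul, Finset.mul_sum]
  refine Finset.sum_congr rfl fun p hp => ?_
  have hp' : p ≤ z.1 ∧ p ≤ z.2 := by simp at hp; omega
  simp only [Nat.add_sub_cancel' hp'.1, Nat.add_sub_cancel' hp'.2]

/-! ### The diagonal operator and the basis -/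

theorem summable_amp_sq' (x : RealSeq) : Summable fun n => amp x n ^ 2 := by
  refine Summable.of_nonneg_of_le (fun _ => sq_nonneg _) (fun n => ?_) (hasSum_sq x).summable
  rw [amp, div_pow]
  refine div_le_self (sq_nonneg _) (one_le_pow₀ ?_)
  linarith [n.cast_nonneg (α := ℝ)]

/-- The sequence of amplitudes of `x`, as a linear map of `ℓ²`. -/
def shrinkLin : RealSeq →ₗ[ℝ] RealSeq where
  toFun x := (⟨amp x, memlp_two_iff.2 (summable_amp_sq' x)⟩ : RealSeq)
  map_add' x y := by ext n; exact amp_add x y n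
  map_smul' c x := by ext n; exact amp_smul c x n

theorem norm_shrinkLin_le (x : RealSeq) : ‖shrinkLin x‖ ≤ 1 * ‖x‖ := by
  rw [one_mul]
  refine abs_le_of_sq_le_sq' ?_ (by positivity) |>.2
  rw [← (hasSum_sq _).tsum_eq, ← (hasSum_sq x).tsum_eq]
  refine (summable_amp_sq' x).tsum_le_tsum (fun n => ?_) (hasSum_sq x).summable
  change amp x n ^ 2 ≤ _
  rw [amp, div_pow]
  refine div_le_self (sq_nonneg _) (one_le_pow₀ ?_)
  linarith [n.cast_nonneg (α := ℝ)]

/-- The sequence of amplitudes of `x`, as a bounded operator of `ℓ²`. -/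
def shrink : RealSeq →L[ℝ] RealSeq := shrinkLin.mkContinuous 1 norm_shrinkLin_le

theorem shrink_apply (x : RealSeq) (n : ℕ) : shrink x n = amp x n := rfl

theorem norm_shrink_le (x : RealSeq) : ‖shrink x‖ ≤ ‖x‖ :=
  (norm_shrinkLin_le x).trans_eq (one_mul _)

theorem inner_shrink_comm (x y : RealSeq) : ⟪shrink x, y⟫_ℝ = ⟪x, shrink y⟫_ℝ := by
  rw [← (hasSum_mul _ _).tsum_eq, ← (hasSum_mul _ _).tsum_eq]
  refine tsum_congr fun n => ?_
  simp only [shrink_apply, amp]; ring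

/-- The element of the energy space whose amplitudes are `unitSeq n`. -/
def mode (n : ℕ) : RealSeq := lp.single 2 n ((n : ℝ) + 1)

theorem amp_mode (n : ℕ) : amp (mode n) = unitSeq n := by
  funext m
  have : (n : ℝ) + 1 ≠ 0 := by positivity
  by_cases h : m = n
  · subst h
    simp [amp, mode, unitSeq, div_self this]
  · simp [amp, mode, unitSeq, h]

theorem inner_mode (n : ℕ) (x : RealSeq) : ⟪mode n, x⟫_ℝ = ((n : ℝ) + 1) * x n := by
  rw [mode, lp.inner_single_left]
  simp [mul_comm]

theorem eq_zero_of_mode (f : RealSeq →L[ℝ] ℝ) (h : ∀ n, f (mode n) = 0) : f = 0 := by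
  ext x
  have hx := (lp.hasSum_single (p := 2) (by norm_num) x).mapL f
  refine hx.unique ?_
  rw [zero_apply]
  convert hasSum_zero using 2 with n
  have hn : (n : ℝ) + 1 ≠ 0 := by positivity
  have : lp.single 2 n (x n) = (x n / ((n : ℝ) + 1)) • mode n := by
    rw [mode, ← lp.single_smul, smul_eq_mul, div_mul_cancel₀ _ hn]
  rw [this, map_smul, h, smul_zero]

/-- Taking the first argument to be a mode isolates one row of the quartic form: these are the
series in the stationary equation and in `L_±`. -/
theorem hasSum_row (n : ℕ) (y u v : RealSeq) :
    HasSum (fun j : ℕ => amp y j *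
      ∑ k ∈ Finset.range (n + j + 1), S n j k * (amp u k * amp v (n + j - k)))
      ⟪cone (mode n) y, cone u v⟫_ℝ := by
  have h := hasSum_quartic (mode n) y u v
  have hi : Function.Injective (fun j : ℕ => (n, j)) := fun a b h => by simpa using h
  rw [← hi.hasSum_iff] at h
  · convert h using 2 with j
    simp [amp_mode, unitSeq]
  · rintro ⟨m, j⟩ hm
    have : m ≠ n := by rintro rfl; exact hm ⟨j, rfl⟩
    simp [amp_mode, unitSeq, this]

/-- The inner product of a real inner product space, as a bounded bilinear map. -/
def ip (F : Type*) [NormedAddCommGroup F] [InnerProductSpace ℝ F] : F →L[ℝ] F →L[ℝ] ℝ :=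
  LinearMap.mkContinuous₂ (innerₗ F) 1 fun x y => by
    rw [one_mul]
    exact abs_real_inner_le_norm x y

@[simp]
theorem ip_apply {F : Type*} [NormedAddCommGroup F] [InnerProductSpace ℝ F] (x y : F) :
    ip F x y = ⟪x, y⟫_ℝ := rfl

/-! ### Stationary states as critical points -/

theorem finiteEnergy_iff (A : RealSeq) : FiniteEnergy (toComplex A) ↔ ∃ x, shrink x = A := by
  constructor
  · intro h
    have h' : Summable fun n : ℕ => (((n : ℝ) + 1) * A n) ^ 2 := by
      refine h.congr fun n => ?_
      simp only [toComplex, Complex.norm_real, Real.norm_eq_abs, sq_abs, mul_pow]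
    refine ⟨⟨fun n => ((n : ℝ) + 1) * A n, memlp_two_iff.2 h'⟩, ?_⟩
    ext n
    have : (n : ℝ) + 1 ≠ 0 := by positivity
    change ((n : ℝ) + 1) * A n / ((n : ℝ) + 1) = A n
    field_simp
  · rintro ⟨x, rfl⟩
    refine (hasSum_sq x).summable.congr fun n => ?_
    simp only [toComplex, Complex.norm_real, Real.norm_eq_abs, sq_abs, shrink_apply, ← mul_pow,
      mul_amp]

/-- The Euler–Lagrange equation `dK(x) = 0` for `K = H / 2 - (1 + 2 om) Q + om E`. -/
def IsCritical (om : ℝ) (x : RealSeq) : Prop :=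
  ∀ y : RealSeq, ⟪cone x x, cone x y⟫_ℝ = (1 + 2 * om) * ⟪shrink x, y⟫_ℝ - om * ⟪x, y⟫_ℝ

/-- The derivative of `K` at `x`. -/
def grad (om : ℝ) (x : RealSeq) : RealSeq →L[ℝ] ℝ :=
  (ip ConeSeq (cone x x)).comp (cone x) - (1 + 2 * om) • ip RealSeq (shrink x) + om • ip RealSeq x

theorem grad_apply (om : ℝ) (x y : RealSeq) : grad om x y =
    ⟪cone x x, cone x y⟫_ℝ - (1 + 2 * om) * ⟪shrink x, y⟫_ℝ + om * ⟪x, y⟫_ℝ := by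
  simp [grad]

theorem isCritical_iff_grad (om : ℝ) (x : RealSeq) : IsCritical om x ↔ grad om x = 0 := by
  constructor
  · intro h
    ext y
    rw [grad_apply, h y]
    simp
  · intro h y
    have := grad_apply om x y
    rw [h, zero_apply] at this
    linarith

/-- The stationary equation at index `n` is the Euler–Lagrange equation tested against `mode n`,
since `(n+1)(1+om-n*om) = (1+2*om)(n+1) - om*(n+1)^2`; the modes span a dense subspace. -/
theorem isStationary_shrink_iff (om : ℝ) (x : RealSeq) :
    IsStationary (1 + om) om (shrink x) ↔ IsCritical om x := by
  have key : ∀ n : ℕ, ((n : ℝ) + 1) * (1 + om - n * om) * (shrink x) n =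
      (∑' j : ℕ, ∑ k ∈ Finset.range (n + j + 1),
        S n j k * ((shrink x) j * (shrink x) k * (shrink x) (n + j - k))) ↔
      grad om x (mode n) = 0 := by
    intro n
    have h1 := (hasSum_row n x x x).tsum_eq
    have h2 : ∀ j : ℕ, ∑ k ∈ Finset.range (n + j + 1),
        S n j k * ((shrink x) j * (shrink x) k * (shrink x) (n + j - k)) =
        amp x j * ∑ k ∈ Finset.range (n + j + 1), S n j k * (amp x k * amp x (n + j - k)) := by
      intro j
      rw [Finset.mul_sum]
      exact Finset.sum_congr rfl fun k _ => by simp only [shrink_apply]; ring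
    rw [tsum_congr h2, h1, grad_apply, cone_comm (mode n) x, real_inner_comm,
      real_inner_comm _ (shrink x), real_inner_comm _ x, inner_mode, inner_mode, shrink_apply,
      ← mul_amp x n]
    constructor <;> intro h <;> linarith
  rw [isCritical_iff_grad]
  constructor
  · intro h
    exact eq_zero_of_mode _ fun n => (key n).1 (h.2 n)
  · intro h
    exact ⟨(finiteEnergy_iff _).2 ⟨x, rfl⟩, fun n => (key n).2 (by rw [h, zero_apply])⟩

/-! ### The Hessian forms -/

/-- The quadratic form of `L_±` (for `s = ±1`) on the energy space. -/
def hessForm (s om : ℝ) (A : RealSeq) : RealSeq →L[ℝ] RealSeq →L[ℝ] ℝ :=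
  (2 : ℝ) • (ip ConeSeq).bilinearComp (cone A) (cone A) +
    s • (ContinuousLinearMap.compL ℝ RealSeq ConeSeq ℝ (ip ConeSeq (cone A A))).comp cone -
    (1 + 2 * om) • (ip RealSeq).comp shrink + om • ip RealSeq

theorem hessForm_apply (s om : ℝ) (A x y : RealSeq) : hessForm s om A x y =
    2 * ⟪cone A x, cone A y⟫_ℝ + s * ⟪cone A A, cone x y⟫_ℝ - (1 + 2 * om) * ⟪shrink x, y⟫_ℝ +
      om * ⟪x, y⟫_ℝ := by
  simp [hessForm]

theorem hessForm_comm (s om : ℝ) (A x y : RealSeq) : hessForm s om A x y = hessForm s om A y x := by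
  rw [hessForm_apply, hessForm_apply, real_inner_comm, cone_comm x y, inner_shrink_comm,
    real_inner_comm _ x, real_inner_comm x y]

/-- The bilinear form `∑ (n - 1) (n + 1) a_n b_n`. -/
def disp : RealSeq →L[ℝ] RealSeq →L[ℝ] ℝ := ip RealSeq - (2 : ℝ) • (ip RealSeq).comp shrink

theorem disp_apply (x y : RealSeq) : disp x y = ⟪x, y⟫_ℝ - 2 * ⟪shrink x, y⟫_ℝ := by
  simp [disp]

theorem disp_comm (x y : RealSeq) : disp x y = disp y x := by
  rw [disp_apply, disp_apply, inner_shrink_comm, real_inner_comm, real_inner_comm _ x]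

/-- The bilinear form `∑ (n - 1) a_n b_n`. -/
def dispMinus : RealSeq →L[ℝ] RealSeq →L[ℝ] ℝ :=
  (ip RealSeq).comp shrink - (2 : ℝ) • (ip RealSeq).bilinearComp shrink shrink

theorem dispMinus_apply (x y : RealSeq) :
    dispMinus x y = ⟪shrink x, y⟫_ℝ - 2 * ⟪shrink x, shrink y⟫_ℝ := by
  simp [dispMinus]

/-! ### The second eigenmode -/

/-- Here `S 1 j 1 = min 1 j + 1`, which is `2` except at `j = 0`; hence the correction at index `0`.
-/
theorem inner_cone_mode_one (x y : RealSeq) :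
    ⟪cone (mode 1) x, cone (mode 1) y⟫_ℝ = 2 * ⟪shrink x, shrink y⟫_ℝ - amp x 0 * amp y 0 := by
  refine (hasSum_row 1 x (mode 1) y).unique ?_
  have h1 := (hasSum_mul (shrink x) (shrink y)).mul_left 2
  have h2 := hasSum_ite_eq (0 : ℕ) (amp x 0 * amp y 0)
  convert! h1.sub h2 using 2 with j
  rw [Finset.sum_eq_single 1]
  · rcases j with _ | j
    · simp [S, amp_mode, unitSeq, shrink_apply]; ring
    · have : 1 + (j + 1) - 1 = j + 1 := by omega
      simp [S, amp_mode, unitSeq, shrink_apply, this]; ring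
  · intro k _ hk
    simp [amp_mode, unitSeq, hk]
  · intro h
    simp at h

theorem inner_cone_mode_one_mode_one (x y : RealSeq) :
    ⟪cone (mode 1) (mode 1), cone x y⟫_ℝ =
      amp x 0 * amp y 2 + 2 * (amp x 1 * amp y 1) + amp x 2 * amp y 0 := by
  refine (hasSum_row 1 (mode 1) x y).unique ?_
  convert hasSum_ite_eq (1 : ℕ)
    (amp x 0 * amp y 2 + 2 * (amp x 1 * amp y 1) + amp x 2 * amp y 0) using 2 with j
  by_cases h : j = 1
  · subst h
    simp [amp_mode, unitSeq, Finset.sum_range_succ, S]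
    norm_num
  · simp [amp_mode, unitSeq, h]

theorem hasSum_hessForm_mode_one (s om : ℝ) (x y : RealSeq) :
    HasSum (fun n : ℕ => (4 - (1 + 2 * om) * ((n : ℝ) + 1) + om * ((n : ℝ) + 1) ^ 2) *
      (amp x n * amp y n))
      (hessForm s om (mode 1) x y + 2 * (amp x 0 * amp y 0) -
        s * (amp x 0 * amp y 2 + 2 * (amp x 1 * amp y 1) + amp x 2 * amp y 0)) := by
  rw [hessForm_apply, inner_cone_mode_one, inner_cone_mode_one_mode_one]
  have h1 := (hasSum_mul (shrink x) (shrink y)).mul_left 4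
  have h2 := (hasSum_mul (shrink x) y).mul_left (1 + 2 * om)
  have h3 := (hasSum_mul x y).mul_left om
  convert! (h1.sub h2).add h3 using 1
  · funext n
    simp only [shrink_apply]
    rw [← mul_amp x n, ← mul_amp y n]
    ring
  · ring

theorem grad_mode_one (om : ℝ) : grad om (mode 1) = 0 := by
  ext y
  rw [grad_apply, cone_comm (mode 1) y, inner_cone_mode_one_mode_one,
    real_inner_comm _ (shrink (mode 1)), ← inner_shrink_comm, real_inner_comm, inner_mode,
    inner_mode, shrink_apply, ← mul_amp y 1]
  simp [amp_mode, unitSeq]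
  ring

/-- `M - 2` annihilates `e_1`. This makes `e_1` critical with a `z`-linear term in `om` only at
first order, and lets the combined constraint be divided by `ε` along a branch. -/
theorem disp_mode_one (y : RealSeq) : disp (mode 1) y = 0 := by
  rw [disp_apply, inner_shrink_comm, inner_mode, inner_mode, shrink_apply, ← mul_amp y 1]
  push_cast; ring

theorem dispMinus_mode_one (y : RealSeq) : dispMinus (mode 1) y = 0 := by
  rw [dispMinus_apply, inner_shrink_comm, inner_shrink_comm, inner_mode, inner_mode, shrink_apply,
    shrink_apply, amp, amp, shrink_apply, amp]
  push_cast; ring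

theorem inner_shrink_mode_one (y : RealSeq) : ⟪shrink (mode 1), shrink y⟫_ℝ = amp y 1 := by
  rw [inner_shrink_comm, inner_mode, shrink_apply, amp, shrink_apply]
  push_cast; ring

/-- What is needed of the frequency `om` and of the direction `v` for a branch of minimizers to
bifurcate from the second eigenmode. -/
structure IsBifurcation (om : ℝ) (v : RealSeq) : Prop where
  om_pos : 0 < om
  decay : ∃ K : ℝ, ∀ n : ℕ, ((n : ℝ) + 1) ^ 4 * |amp v n| ≤ K
  plus : ∃ c > 0, ∃ C ≥ 0, ∀ x, c * ‖x‖ ^ 2 ≤ hessForm 1 om (mode 1) x x + C * disp v x ^ 2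
  minus : ∃ c > 0, ∃ C ≥ 0, ∀ x, c * ‖x‖ ^ 2 ≤
    hessForm (-1) om (mode 1) x x + C * (amp x 1 ^ 2 + dispMinus v x ^ 2)
  ker : ∀ x, hessForm 1 om (mode 1) v x = 0
  nondegenerate : disp v v ≠ 0
  cubic : ⟪cone (mode 1) v, cone v v⟫_ℝ = 0

/-! ### The two bifurcation points -/

theorem disp_mode (n : ℕ) (x : RealSeq) :
    disp (mode n) x = ((n : ℝ) + 1) * ((n : ℝ) - 1) * amp x n := by
  rw [disp_apply, inner_shrink_comm, inner_mode, inner_mode, shrink_apply, ← mul_amp x n]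
  ring

theorem dispMinus_mode (n : ℕ) (x : RealSeq) :
    dispMinus (mode n) x = ((n : ℝ) - 1) * amp x n := by
  have h : ⟪shrink (mode n), shrink x⟫_ℝ = amp x n := by
    rw [inner_shrink_comm, inner_mode, shrink_apply, mul_amp, shrink_apply]
  rw [dispMinus_apply, h, inner_shrink_comm, inner_mode, shrink_apply]
  ring

theorem hessForm_mode (s om : ℝ) (n : ℕ) (x : RealSeq) :
    hessForm s om (mode 1) (mode n) x =
      (4 - (1 + 2 * om) * ((n : ℝ) + 1) + om * ((n : ℝ) + 1) ^ 2) * amp x n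
        - 2 * (unitSeq n 0 * amp x 0)
        + s * (unitSeq n 0 * amp x 2 + 2 * (unitSeq n 1 * amp x 1) + unitSeq n 2 * amp x 0) := by
  have h1 := hasSum_hessForm_mode_one s om (mode n) x
  have h2 := h1.unique (a₂ := (4 - (1 + 2 * om) * ((n : ℝ) + 1) + om * ((n : ℝ) + 1) ^ 2) *
    amp x n) (by
    convert! hasSum_ite_eq n ((4 - (1 + 2 * om) * ((n : ℝ) + 1) + om * ((n : ℝ) + 1) ^ 2) *
      amp x n) using 2 with m
    by_cases h : m = n
    · subst h; simp [amp_mode, unitSeq]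
    · simp [amp_mode, unitSeq, h])
  rw [amp_mode] at h2
  linarith

/-- The diagonal part beyond index `N` already dominates `c‖x‖²`, so coercivity reduces to a
quadratic inequality in finitely many amplitudes. -/
theorem hessForm_mode_one_ge {c om : ℝ} {N : ℕ} (s : ℝ)
    (h : ∀ n, N ≤ n → c * ((n : ℝ) + 1) ^ 2 ≤
      4 - (1 + 2 * om) * ((n : ℝ) + 1) + om * ((n : ℝ) + 1) ^ 2) (x : RealSeq) :
    c * ‖x‖ ^ 2 + ∑ n ∈ Finset.range N, (4 - (1 + 2 * om) * ((n : ℝ) + 1) +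
      om * ((n : ℝ) + 1) ^ 2 - c * ((n : ℝ) + 1) ^ 2) * amp x n ^ 2 ≤
      hessForm s om (mode 1) x x + 2 * amp x 0 ^ 2 -
        s * (2 * (amp x 0 * amp x 2) + 2 * amp x 1 ^ 2) := by
  have h1 := (hasSum_hessForm_mode_one s om x x).sub ((hasSum_sq x).mul_left c)
  have h2 := sum_le_hasSum (Finset.range N) (fun n hn => by
    have := h n (by simpa using hn)
    rw [← mul_amp x n]
    nlinarith [sq_nonneg (amp x n)]) h1
  rw [Finset.sum_congr rfl fun (n : ℕ) _ => (by rw [← mul_amp x n]; ring :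
    (4 - (1 + 2 * om) * ((n : ℝ) + 1) + om * ((n : ℝ) + 1) ^ 2) * (amp x n * amp x n) -
      c * x n ^ 2 = (4 - (1 + 2 * om) * ((n : ℝ) + 1) +
      om * ((n : ℝ) + 1) ^ 2 - c * ((n : ℝ) + 1) ^ 2) * amp x n ^ 2)] at h2
  linarith

/-- In each term the indices satisfy `1 + j = k + (1 + j - k)`, so one of `j`, `k`, `1 + j - k` is
odd. -/
theorem cubic_eq_zero {v : RealSeq} (h : ∀ n, Odd n → amp v n = 0) :
    ⟪cone (mode 1) v, cone v v⟫_ℝ = 0 := by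
  refine (hasSum_row 1 v v v).unique ?_
  convert! hasSum_zero using 2 with j
  rcases Nat.even_or_odd j with hj | hj
  · rw [Finset.sum_eq_zero, mul_zero]
    intro k hk
    rcases Nat.even_or_odd k with hk' | hk'
    · rw [h (1 + j - k)]
      · ring
      · simp only [Finset.mem_range] at hk
        have : k ≤ 1 + j := by omega
        rw [Nat.odd_sub this]
        grind
    · rw [h k hk']
      ring
  · rw [h j hj, zero_mul]

theorem amp_two : amp ((3 : ℝ) • mode 0 - mode 2) = (3 : ℕ) • unitSeq 0 - unitSeq 2 := by
  funext n
  rw [sub_eq_add_neg, ← neg_one_smul ℝ, amp_add, amp_smul, amp_smul, amp_mode, amp_mode]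
  simp
  ring

/-- At `om = 2/3` the block of `L_±` on modes `0` and `2` is `[[1/3, ±1], [±1, 3]]`, of determinant
zero, with kernel `(3, ∓1)`. -/
theorem isBifurcation_two : IsBifurcation (2 / 3) ((3 : ℝ) • mode 0 - mode 2) where
  om_pos := by norm_num
  decay := by
    refine ⟨81, fun n => ?_⟩
    rw [amp_two]
    by_cases h0 : n = 0
    · subst h0; norm_num [unitSeq]
    by_cases h2 : n = 2
    · subst h2; norm_num [unitSeq]
    · simp [unitSeq, h0, h2]
  plus := by
    refine ⟨1 / 12, by norm_num, 1, by norm_num, fun x => ?_⟩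
    have h := hessForm_mode_one_ge (c := 1 / 12) (om := 2 / 3) (N := 3) 1 (fun n _ => by
      nlinarith [sq_nonneg ((n : ℝ) + 1 - 2)]) x
    simp only [map_sub, map_smul, sub_apply, smul_apply,
      disp_mode, smul_eq_mul]
    norm_num [Finset.sum_range_succ] at h ⊢
    -- On modes `0` and `2` the remaining form is `37/4 a₀² + 20 a₀a₂ + 45/4 a₂²`, only barely
    -- definite; the last square is adapted to it.
    nlinarith [sq_nonneg (amp x 0 + amp x 2), sq_nonneg (amp x 0), sq_nonneg (amp x 1),
      sq_nonneg (amp x 2), sq_nonneg (19 * amp x 0 + 20 * amp x 2)]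
  minus := by
    refine ⟨1 / 12, by norm_num, 1, by norm_num, fun x => ?_⟩
    have h := hessForm_mode_one_ge (c := 1 / 12) (om := 2 / 3) (N := 3) (-1) (fun n _ => by
      nlinarith [sq_nonneg ((n : ℝ) + 1 - 2)]) x
    simp only [map_sub, map_smul, sub_apply, smul_apply,
      dispMinus_mode, smul_eq_mul]
    norm_num [Finset.sum_range_succ] at h ⊢
    nlinarith [sq_nonneg (amp x 0 + amp x 2), sq_nonneg (amp x 0), sq_nonneg (amp x 1),
      sq_nonneg (amp x 2)]
  ker x := by
    simp only [map_sub, map_smul, sub_apply, smul_apply,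
      hessForm_mode, smul_eq_mul]
    simp [unitSeq]
    ring
  nondegenerate := by
    simp only [map_sub, map_smul, sub_apply, smul_apply,
      disp_mode, smul_eq_mul, amp_mode]
    norm_num [unitSeq]
  cubic := by
    refine cubic_eq_zero fun n hn => ?_
    have h0 : n ≠ 0 := by rintro rfl; simp at hn
    have h2 : n ≠ 2 := by rintro rfl; exact absurd hn (by decide)
    rw [amp_two]
    simp [unitSeq, h0, h2]

/-- At `om = 3/35` the diagonal entry `om*(n+1)*(n-1) - (n-3)` vanishes at `n = 6`, while the block
on modes `0` and `2` is positive definite. -/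
theorem isBifurcation_six : IsBifurcation (3 / 35) (mode 6) where
  om_pos := by norm_num
  decay := by
    refine ⟨2401, fun n => ?_⟩
    rw [amp_mode]
    by_cases h2 : n = 6
    · subst h2; norm_num [unitSeq]
    · simp [unitSeq, h2]
  plus := by
    -- The neighbouring modes `5` and `7` have entries only `2/35` and `4/35`, which must exceed
    -- `36c` and `64c`.
    refine ⟨1 / 1000, by norm_num, 1, by norm_num, fun x => ?_⟩
    have h := hessForm_mode_one_ge (c := 1 / 1000) (om := 3 / 35) (N := 8) 1 (fun n hn => by
      have : (8 : ℝ) ≤ n := by exact_mod_cast hn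
      nlinarith) x
    rw [disp_mode]
    norm_num [Finset.sum_range_succ] at h ⊢
    nlinarith [sq_nonneg (amp x 0 + amp x 2), sq_nonneg (amp x 0), sq_nonneg (amp x 1),
      sq_nonneg (amp x 2), sq_nonneg (amp x 3), sq_nonneg (amp x 4), sq_nonneg (amp x 5),
      sq_nonneg (amp x 6), sq_nonneg (amp x 7)]
  minus := by
    refine ⟨1 / 1000, by norm_num, 1, by norm_num, fun x => ?_⟩
    have h := hessForm_mode_one_ge (c := 1 / 1000) (om := 3 / 35) (N := 8) (-1) (fun n hn => by
      have : (8 : ℝ) ≤ n := by exact_mod_cast hn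
      nlinarith) x
    rw [dispMinus_mode]
    norm_num [Finset.sum_range_succ] at h ⊢
    nlinarith [sq_nonneg (amp x 0 - amp x 2), sq_nonneg (amp x 0), sq_nonneg (amp x 1),
      sq_nonneg (amp x 2), sq_nonneg (amp x 3), sq_nonneg (amp x 4), sq_nonneg (amp x 5),
      sq_nonneg (amp x 6), sq_nonneg (amp x 7)]
  ker x := by
    rw [hessForm_mode]
    norm_num [unitSeq]
  nondegenerate := by
    rw [disp_mode, amp_mode]
    norm_num [unitSeq]
  cubic := by
    refine cubic_eq_zero fun n hn => ?_
    have h6 : n ≠ 6 := by rintro rfl; exact absurd hn (by decide)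
    simp [amp_mode, unitSeq, h6]

open Filter Topology

/-! ### Existence of branches -/

/-- The equation for `z` and `om` which expresses that `mode 1 + ε z` is a stationary state. -/
def resid (om₀ : ℝ) (u : ℝ × (RealSeq × ℝ)) : RealSeq →L[ℝ] ℝ :=
  hessForm 1 om₀ (mode 1) u.2.1 + (u.2.2 - om₀) • disp u.2.1 +
    u.1 • ((ip ConeSeq (cone u.2.1 u.2.1)).comp (cone (mode 1)) +
      (2 : ℝ) • (ip ConeSeq (cone (mode 1) u.2.1)).comp (cone u.2.1)) +
    u.1 ^ 2 • (ip ConeSeq (cone u.2.1 u.2.1)).comp (cone u.2.1)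

/-- `mode 1` is critical for every `om`, so the gradient at `mode 1 + ε z` is divisible by `ε`. The
quotient `resid` no longer sees the trivial branch. -/
theorem grad_mode_one_add (om₀ ε om : ℝ) (z : RealSeq) :
    grad om (mode 1 + ε • z) = ε • resid om₀ (ε, z, om) := by
  have h0 := grad_mode_one om
  ext d
  have h1 : grad om (mode 1) d = 0 := by rw [h0, zero_apply]
  rw [grad_apply] at h1
  simp only [grad_apply, resid, hessForm_apply, disp_apply, add_apply, smul_apply, smul_eq_mul,
    map_add, map_smul, inner_add_left, inner_add_right, real_inner_smul_left,
    real_inner_smul_right, ContinuousLinearMap.comp_apply, ip_apply, cone_comm z (mode 1)]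
  linear_combination h1

theorem contDiff_resid (om₀ : ℝ) : ContDiff ℝ ω (resid om₀) := by
  unfold resid
  fun_prop

/-- The system consisting of `resid` and of a normalization of `z`. -/
def branchMap (om₀ : ℝ) (v : RealSeq) (u : ℝ × (RealSeq × ℝ)) : (RealSeq →L[ℝ] ℝ) × ℝ :=
  (resid om₀ u, disp v u.2.1)

/-- The derivative of `branchMap` in `(z, om)` at the bifurcation point. -/
def branchDeriv (om₀ : ℝ) (v : RealSeq) : (RealSeq × ℝ) →L[ℝ] (RealSeq →L[ℝ] ℝ) × ℝ :=
  ((hessForm 1 om₀ (mode 1)).comp (.fst ℝ RealSeq ℝ) +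
    (ContinuousLinearMap.snd ℝ RealSeq ℝ).smulRight (disp v)).prod
    ((disp v).comp (.fst ℝ RealSeq ℝ))

theorem branchDeriv_apply (om₀ : ℝ) (v : RealSeq) (p : RealSeq × ℝ) : branchDeriv om₀ v p =
    (hessForm 1 om₀ (mode 1) p.1 + p.2 • disp v, disp v p.1) := by
  simp [branchDeriv]

theorem contDiff_branchMap (om₀ : ℝ) (v : RealSeq) : ContDiff ℝ ω (branchMap om₀ v) :=
  (contDiff_resid om₀).prodMk (by fun_prop)

theorem fderiv_branchMap (om₀ : ℝ) (v : RealSeq) :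
    fderiv ℝ (branchMap om₀ v) (0, (v, om₀)) ∘L .inr ℝ ℝ (RealSeq × ℝ) = branchDeriv om₀ v := by
  have h1 : HasFDerivAt (branchMap om₀ v) (fderiv ℝ (branchMap om₀ v) (0, (v, om₀)))
      ((ContinuousLinearMap.inr ℝ ℝ (RealSeq × ℝ)) (v, om₀)) :=
    ((contDiff_branchMap om₀ v).differentiable (by simp) _).hasFDerivAt
  have h2 := h1.comp (v, om₀) (ContinuousLinearMap.inr ℝ ℝ (RealSeq × ℝ)).hasFDerivAt
  refine h2.unique ?_
  -- On the slice `ε = 0` the higher-order terms disappear and the map is bilinear in `(z, om)` up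
  -- to affine terms.
  have h3 : branchMap om₀ v ∘ (ContinuousLinearMap.inr ℝ ℝ (RealSeq × ℝ)) = fun p =>
      (hessForm 1 om₀ (mode 1) p.1 + (p.2 - om₀) • disp p.1, disp v p.1) := by
    funext p
    simp [branchMap, resid]
  rw [h3]
  have ha : HasFDerivAt (fun p : RealSeq × ℝ => p.1) (.fst ℝ RealSeq ℝ) (v, om₀) := hasFDerivAt_fst
  have hb : HasFDerivAt (fun p : RealSeq × ℝ => p.2 - om₀) (.snd ℝ RealSeq ℝ) (v, om₀) :=
    hasFDerivAt_snd.sub_const om₀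
  have hc := ((hessForm 1 om₀ (mode 1)).hasFDerivAt.comp (v, om₀) ha).add
    (hb.smul (disp.hasFDerivAt.comp (v, om₀) ha))
  have hd := hc.prodMk ((disp v).hasFDerivAt.comp (v, om₀) ha)
  refine hd.congr_fderiv ?_
  ext p <;> simp [branchDeriv]

/-- A rank-one correction in the detecting functional `disp v` removes the kernel, which makes
Lax–Milgram applicable. -/
theorem isCoercive_hessForm {om₀ : ℝ} {v : RealSeq} (h : IsBifurcation om₀ v) :
    ∃ C : ℝ, IsCoercive (hessForm 1 om₀ (mode 1) + C • (disp v).smulRight (disp v)) := by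
  obtain ⟨c, hc, C, -, hC⟩ := h.plus
  refine ⟨C, c, hc, fun x => ?_⟩
  have := hC x
  simp only [add_apply, smul_apply, ContinuousLinearMap.smulRight_apply, smul_eq_mul]
  nlinarith

theorem branchDeriv_injective {om₀ : ℝ} {v : RealSeq} (h : IsBifurcation om₀ v) :
    Function.Injective (branchDeriv om₀ v) := by
  rw [injective_iff_map_eq_zero]
  rintro ⟨z, w⟩ hz
  rw [branchDeriv_apply, Prod.mk_eq_zero] at hz
  obtain ⟨h1, h2⟩ := hz
  simp only at h1 h2
  -- Pairing with the kernel vector `v` leaves only `w * disp v v`.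
  have hw : w = 0 := by
    have := congrArg (fun f : RealSeq →L[ℝ] ℝ => f v) h1
    simp only [add_apply, smul_apply, smul_eq_mul, zero_apply] at this
    rw [hessForm_comm, h.ker, zero_add] at this
    exact (mul_eq_zero.1 this).resolve_right h.nondegenerate
  subst hw
  obtain ⟨c, hc, C, -, hC⟩ := h.plus
  have h3 := hC z
  rw [h2] at h3
  rw [zero_smul, add_zero] at h1
  rw [h1] at h3
  simp only [zero_apply] at h3
  have : ‖z‖ ^ 2 ≤ 0 := by nlinarith
  have hz : z = 0 := by
    rw [← norm_eq_zero]
    exact pow_eq_zero_iff (two_ne_zero) |>.1 (le_antisymm this (sq_nonneg _))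
  rw [hz]; rfl

theorem branchDeriv_surjective {om₀ : ℝ} {v : RealSeq} (h : IsBifurcation om₀ v) :
    Function.Surjective (branchDeriv om₀ v) := by
  rintro ⟨f, c⟩
  obtain ⟨C, hco⟩ := isCoercive_hessForm h
  -- This is the Fredholm solvability condition: `w` makes `g = f - w • disp v` vanish on `v`.
  set w : ℝ := f v / disp v v with hw
  set g : RealSeq →L[ℝ] ℝ := f - w • disp v with hg
  have hgv : g v = 0 := by
    have := h.nondegenerate
    simp only [hg, hw, sub_apply, smul_apply, smul_eq_mul]
    field_simp; ring
  set y := (InnerProductSpace.toDual ℝ RealSeq).symm g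
  obtain ⟨z, hz⟩ := hco.continuousLinearEquivOfBilin.surjective y
  have h1 : ∀ x, hessForm 1 om₀ (mode 1) z x + C * (disp v z * disp v x) = g x := by
    intro x
    have h2 := hco.continuousLinearEquivOfBilin_apply z x
    rw [hz, InnerProductSpace.toDual_symm_apply] at h2
    rw [h2]
    simp
  -- Testing with `v` shows that the rank-one correction is inactive, so `z` solves the original
  -- equation; a multiple of `v` then adjusts the normalization.
  have h2 : C * disp v z = 0 := by
    have := h1 v
    rw [hessForm_comm, h.ker, hgv, zero_add, ← mul_assoc] at this
    exact (mul_eq_zero.1 this).resolve_right h.nondegenerate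
  refine ⟨(z + ((c - disp v z) / disp v v) • v, w), ?_⟩
  have hnd := h.nondegenerate
  rw [branchDeriv_apply]
  ext x
  · simp only [map_add, map_smul, add_apply, smul_apply, smul_eq_mul, h.ker, mul_zero, add_zero]
    have h3 := h1 x
    simp only [hg, sub_apply, smul_apply, smul_eq_mul] at h3
    linear_combination h3 - disp v x * h2
  · simp only [map_add, map_smul, smul_eq_mul]
    field_simp; ring

theorem abs_amp_le (x : RealSeq) (n : ℕ) : |amp x n| ≤ ‖x‖ :=
  (lp.norm_apply_le_norm (by norm_num) (shrink x) n).trans (norm_shrink_le x)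

theorem amp_sub (x y : RealSeq) (n : ℕ) : amp (x - y) n = amp x n - amp y n := by
  simp [amp, sub_div]

theorem exists_resid_eq_zero {om₀ : ℝ} {v : RealSeq} (h : IsBifurcation om₀ v) :
    ∃ ψ : ℝ → RealSeq × ℝ, ψ 0 = (v, om₀) ∧ (∀ᶠ ε in 𝓝 0, ContDiffAt ℝ ω ψ ε) ∧
      ∀ᶠ ε in 𝓝 0, resid om₀ (ε, ψ ε) = 0 ∧ disp v (ψ ε).1 = disp v v := by
  have hcd : ContDiffAt ℝ ω (branchMap om₀ v) (0, (v, om₀)) := (contDiff_branchMap om₀ v).contDiffAt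
  have hinv : (fderiv ℝ (branchMap om₀ v) (0, (v, om₀)) ∘L .inr ℝ ℝ (RealSeq × ℝ)).IsInvertible := by
    rw [fderiv_branchMap]
    exact ⟨ContinuousLinearEquiv.ofBijective (branchDeriv om₀ v)
      (LinearMap.ker_eq_bot.2 (branchDeriv_injective h))
      (LinearMap.range_eq_top.2 (branchDeriv_surjective h)),
      ContinuousLinearEquiv.coe_ofBijective _ _ _⟩
  have hn : (ω : WithTop ℕ∞) ≠ 0 := by simp
  refine ⟨hcd.implicitFunction hn hinv, hcd.implicitFunction_apply_self hn hinv,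
    (hcd.contDiffAt_implicitFunction hn hinv).eventually (by simp), ?_⟩
  filter_upwards [hcd.eventually_apply_implicitFunction hn hinv] with ε hε
  have h0 : branchMap om₀ v (0, (v, om₀)) = (0, disp v v) := by
    have : hessForm 1 om₀ (mode 1) v = 0 := by
      ext x
      exact h.ker x
    simp [branchMap, resid, this]
  rw [h0] at hε
  exact ⟨congrArg Prod.fst hε, congrArg Prod.snd hε⟩

theorem exists_isBranch {om₀ : ℝ} {v : RealSeq} (h : IsBifurcation om₀ v) :
    ∃ (r : ℝ) (om : ℝ → ℝ) (A : ℝ → RealSeq), IsBranch om₀ (amp v) r om A := by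
  obtain ⟨ψ, hψ0, hψ, hres⟩ := exists_resid_eq_zero h
  set z : ℝ → RealSeq := fun ε => (ψ ε).1 with hz
  set om : ℝ → ℝ := fun ε => (ψ ε).2 with hom
  have hz0 : z 0 = v := by rw [hz]; simp only [hψ0]
  have hzd : DifferentiableAt ℝ z 0 :=
    (hψ.self_of_nhds.differentiableAt (by simp)).fst
  have hzO : (fun ε => z ε - v) =O[𝓝 0] fun ε : ℝ => ε := by
    simpa [hz0] using hzd.isBigO_sub
  set T : ℝ → ℝ := fun ε => ⟪cone (z ε) (z ε), cone (mode 1) v⟫_ℝ +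
    2 * ⟪cone (mode 1) (z ε), cone (z ε) v⟫_ℝ with hT
  set U : ℝ → ℝ := fun ε => ⟪cone (z ε) (z ε), cone (z ε) v⟫_ℝ with hU
  have hTO : T =O[𝓝 0] fun ε : ℝ => ε := by
    have hd : DifferentiableAt ℝ T 0 := by
      rw [hT]
      refine DifferentiableAt.add (DifferentiableAt.inner ℝ ?_ ?_)
        ((DifferentiableAt.inner ℝ ?_ ?_).const_mul 2) <;> fun_prop
    -- At `ε = 0` the quadratic term paired with `v` is three times the cubic coefficient, which
    -- vanishes by parity.
    have hT0 : T 0 = 0 := by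
      have := h.cubic
      simp only [hT, hz0, real_inner_comm (cone (mode 1) v), this]
      simp
    simpa [hT0] using hd.isBigO_sub
  have hUO : U =O[𝓝 0] fun _ => (1 : ℝ) := by
    have hd : DifferentiableAt ℝ U 0 := by
      rw [hU]
      refine DifferentiableAt.inner ℝ ?_ ?_ <;> fun_prop
    exact hd.continuousAt.isBigO_one ℝ
  have homO : (fun ε => om ε - om₀) =O[𝓝 0] fun ε : ℝ => ε ^ 2 := by
    have h1 : (fun ε => (-(disp v v)⁻¹) * (ε * T ε + ε ^ 2 * U ε)) =O[𝓝 0] fun ε : ℝ => ε ^ 2 := by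
      refine Asymptotics.IsBigO.const_mul_left (Asymptotics.IsBigO.add ?_ ?_) _
      · simpa [sq] using (Asymptotics.isBigO_refl (fun ε : ℝ => ε) (𝓝 0)).mul hTO
      · simpa using (Asymptotics.isBigO_refl (fun ε : ℝ => ε ^ 2) (𝓝 0)).mul hUO
    refine h1.congr' ?_ EventuallyEq.rfl
    filter_upwards [hres] with ε hε
    -- Pairing with `v` removes the linear term and the normalization fixes the coefficient of `om ε
    -- - om₀`, giving an explicit formula for it.
    have h2 : resid om₀ (ε, ψ ε) v = 0 := by rw [hε.1, zero_apply]
    have h3 := h.ker (z ε)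
    rw [hessForm_comm] at h3
    have h4 : disp (z ε) v = disp v v := by rw [disp_comm]; exact hε.2
    simp only [resid, add_apply, smul_apply, ContinuousLinearMap.comp_apply, ip_apply,
      smul_eq_mul] at h2
    change hessForm 1 om₀ (mode 1) (z ε) v + (om ε - om₀) * disp (z ε) v + ε * T ε + ε ^ 2 * U ε = 0
      at h2
    rw [h3, h4] at h2
    have hnd := h.nondegenerate
    field_simp
    linarith
  obtain ⟨C₁, hC₁⟩ := hzO.bound
  obtain ⟨C₂, hC₂⟩ := homO.bound
  obtain ⟨r, hr, hball⟩ := Metric.eventually_nhds_iff.1 ((hψ.and hres).and (hC₁.and hC₂))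
  have hall : ∀ ε ∈ Set.Ioo (-r) r, _ := fun ε hε => @hball ε (by
    rw [Real.dist_eq, sub_zero, abs_lt]; exact hε)
  have hsm : ContDiffOn ℝ ∞ ψ (Set.Ioo (-r) r) := fun ε hε =>
    ((hall ε hε).1.1.of_le (by simp)).contDiffWithinAt
  refine ⟨r, om, fun ε => shrink (mode 1 + ε • z ε), hr, hsm.snd, ?_, ?_, C₁ + C₂, ?_⟩
  · exact shrink.contDiff.comp_contDiffOn
      (contDiffOn_const.add (contDiffOn_id.smul hsm.fst))
  · intro ε hε
    rw [isStationary_shrink_iff, isCritical_iff_grad, grad_mode_one_add om₀]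
    have := (hall ε hε).1.2.1
    change ε • resid om₀ (ε, ψ ε) = 0
    rw [this, smul_zero]
  · intro ε hε n
    have h1 := (hall ε hε).2.1
    have h2 := (hall ε hε).2.2
    have h3 : (shrink (mode 1 + ε • z ε)) n - unitSeq 1 n - ε * amp v n =
        ε * amp (z ε - v) n := by
      rw [shrink_apply, amp_add, amp_smul, amp_sub, amp_mode]
      ring
    rw [h3, abs_mul]
    have h4 := abs_amp_le (z ε - v) n
    simp only [Real.norm_eq_abs, abs_pow, sq_abs] at h1 h2
    have h5 := mul_le_mul_of_nonneg_left (h4.trans h1) (abs_nonneg ε)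
    have h6 := abs_mul_abs_self ε
    linear_combination h2 + h5 + C₁ * h6

/-! ### Decay of stationary states -/

theorem abs_amp_le_half (x : RealSeq) (n : ℕ) :
    |amp x n| ≤ (x n ^ 2 + 1 / ((n : ℝ) + 1) ^ 2) / 2 := by
  have h : amp x n = x n * (1 / ((n : ℝ) + 1)) := by rw [amp]; ring
  have h2 : (1 : ℝ) / ((n : ℝ) + 1) ^ 2 = (1 / ((n : ℝ) + 1)) ^ 2 := by rw [one_div_pow]
  rw [h, h2, abs_mul]
  nlinarith [sq_nonneg (|x n| - |1 / ((n : ℝ) + 1)|), sq_abs (x n), sq_abs (1 / ((n : ℝ) + 1))]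

theorem summable_abs_amp (x : RealSeq) : Summable fun n => |amp x n| :=
  Summable.of_nonneg_of_le (fun _ => abs_nonneg _) (abs_amp_le_half x)
    (((hasSum_sq x).summable.add summable_inv_sq).div_const 2)

theorem tsum_abs_amp_le (x : RealSeq) :
    ∑' n, |amp x n| ≤ (‖x‖ ^ 2 + ∑' n : ℕ, 1 / ((n : ℝ) + 1) ^ 2) / 2 :=
  hasSum_le (abs_amp_le_half x) (summable_abs_amp x).hasSum
    (((hasSum_sq x).add summable_inv_sq.hasSum).div_const 2)

/-- Testing the equation with `x` and discarding the nonnegative quartic term bounds the energy norm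
by the `ℓ²` norm. -/
theorem IsCritical.norm_le {om : ℝ} {x : RealSeq} (h : IsCritical om x) (hom : 0 < om) :
    om * ‖x‖ ≤ (1 + 2 * om) * ‖shrink x‖ := by
  have h1 := h x
  have h2 : 0 ≤ ⟪cone x x, cone x x⟫_ℝ := real_inner_self_nonneg
  have h3 : ⟪shrink x, x⟫_ℝ ≤ ‖shrink x‖ * ‖x‖ := real_inner_le_norm _ _
  rw [real_inner_self_eq_norm_sq x] at h1
  rcases (norm_nonneg x).eq_or_lt with h0 | h0
  · rw [← h0]; nlinarith [norm_nonneg (shrink x)]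
  · refine le_of_mul_le_mul_right ?_ h0
    nlinarith

/-- Since `s + 1 ≤ (k+1) + (s-k+1)`, the weight can be placed on one of the two factors, the other
being summed. -/
theorem pow_mul_convolution_le {f : ℕ → ℝ} (h0 : ∀ n, 0 ≤ f n) (hf : Summable f) {p : ℕ} {G : ℝ}
    (hG : ∀ n : ℕ, ((n : ℝ) + 1) ^ p * f n ≤ G) (s : ℕ) :
    ((s : ℝ) + 1) ^ p * ∑ k ∈ Finset.range (s + 1), f k * f (s - k) ≤
      2 ^ (p + 1) * G * ∑' n, f n := by
  have hG0 : 0 ≤ G := (mul_nonneg (by positivity) (h0 0)).trans (hG 0)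
  have hpart : ∑ k ∈ Finset.range (s + 1), f k ≤ ∑' n, f n := hf.sum_le_tsum _ fun n _ => h0 n
  have hrefl : ∑ k ∈ Finset.range (s + 1), f (s - k) = ∑ k ∈ Finset.range (s + 1), f k := by
    have := Finset.sum_range_reflect f (s + 1)
    simpa using this
  calc ((s : ℝ) + 1) ^ p * ∑ k ∈ Finset.range (s + 1), f k * f (s - k)
      ≤ ∑ k ∈ Finset.range (s + 1), 2 ^ p * G * (f k + f (s - k)) := by
        rw [Finset.mul_sum]
        refine Finset.sum_le_sum fun k hk => ?_
        have hk' : k ≤ s := by simp at hk; omega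
        have e : (s : ℝ) = k + (s - k : ℕ) := by push_cast [Nat.cast_sub hk']; ring
        have h1 : ((s : ℝ) + 1) ^ p ≤ 2 ^ p * (((k : ℝ) + 1) ^ p + (((s - k : ℕ) : ℝ) + 1) ^ p) := by
          calc ((s : ℝ) + 1) ^ p ≤ (((k : ℝ) + 1) + (((s - k : ℕ) : ℝ) + 1)) ^ p := by
                exact pow_le_pow_left₀ (by positivity) (by linarith) p
            _ ≤ 2 ^ (p - 1) * (((k : ℝ) + 1) ^ p + (((s - k : ℕ) : ℝ) + 1) ^ p) :=
                add_pow_le (by positivity) (by positivity) p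
            _ ≤ _ := by
                gcongr
                · norm_num
                · omega
        have h2 := mul_le_mul_of_nonneg_right (hG k) (h0 (s - k))
        have h3 := mul_le_mul_of_nonneg_right (hG (s - k)) (h0 k)
        calc ((s : ℝ) + 1) ^ p * (f k * f (s - k))
            ≤ 2 ^ p * (((k : ℝ) + 1) ^ p + (((s - k : ℕ) : ℝ) + 1) ^ p) * (f k * f (s - k)) :=
              mul_le_mul_of_nonneg_right h1 (mul_nonneg (h0 _) (h0 _))
          _ = 2 ^ p * (((k : ℝ) + 1) ^ p * f k * f (s - k) +
                (((s - k : ℕ) : ℝ) + 1) ^ p * f (s - k) * f k) := by ring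
          _ ≤ 2 ^ p * (G * f (s - k) + G * f k) :=
              mul_le_mul_of_nonneg_left (add_le_add h2 h3) (by positivity)
          _ = _ := by ring
    _ = 2 ^ (p + 1) * G * ∑ k ∈ Finset.range (s + 1), f k := by
        rw [← Finset.mul_sum, Finset.sum_add_distrib, hrefl]; ring
    _ ≤ _ := by gcongr

theorem S_le (n j k : ℕ) : S n j k ≤ (n : ℝ) + 1 := by
  rw [S]
  have : min (min n j) (min k (n + j - k)) + 1 ≤ n + 1 := by omega
  exact_mod_cast this

theorem S_nonneg (n j k : ℕ) : 0 ≤ S n j k := Nat.cast_nonneg _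

/-- The linear symbol grows like `om (n+1)²`, while the nonlinearity loses only the factor `S ≤ n +
1`; each use of the equation therefore gains one power. -/
theorem IsCritical.decay_succ {om : ℝ} {x : RealSeq} (h : IsCritical om x) (hom : 0 < om) {p : ℕ}
    {G M : ℝ} (hG : ∀ n : ℕ, ((n : ℝ) + 1) ^ p * |amp x n| ≤ G) (hM : ∑' n, |amp x n| ≤ M) (n : ℕ) :
    om * (((n : ℝ) + 1) ^ (p + 1) * |amp x n|) ≤ (1 + 2 * om) * G + 2 ^ (p + 1) * G * M ^ 2 := by
  set f : ℕ → ℝ := fun n => |amp x n| with hf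
  have hf0 : ∀ n, 0 ≤ f n := fun n => abs_nonneg _
  have hfs : Summable f := summable_abs_amp x
  have hG0 : 0 ≤ G := le_trans (by positivity) (hG 0)
  have hM0 : 0 ≤ ∑' n, f n := tsum_nonneg hf0
  have hn : (0 : ℝ) < (n : ℝ) + 1 := by positivity
  have hrow := hasSum_row n x x x
  have hval : ⟪cone (mode n) x, cone x x⟫_ℝ =
      ((n : ℝ) + 1) * ((1 + 2 * om) - ((n : ℝ) + 1) * om) * amp x n := by
    have h1 := h (mode n)
    rw [real_inner_comm, cone_comm x (mode n), real_inner_comm (mode n), real_inner_comm (mode n),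
      inner_mode, inner_mode, shrink_apply, ← mul_amp x n] at h1
    rw [h1]; ring
  have hD : ∀ j : ℕ, ((n : ℝ) + 1) ^ p * |amp x j * ∑ k ∈ Finset.range (n + j + 1),
      S n j k * (amp x k * amp x (n + j - k))| ≤
      ((n : ℝ) + 1) * (2 ^ (p + 1) * G * ∑' n, f n) * f j := by
    intro j
    have h1 : |∑ k ∈ Finset.range (n + j + 1), S n j k * (amp x k * amp x (n + j - k))| ≤
        ((n : ℝ) + 1) * ∑ k ∈ Finset.range (n + j + 1), f k * f (n + j - k) := by
      rw [Finset.mul_sum]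
      refine (Finset.abs_sum_le_sum_abs _ _).trans (Finset.sum_le_sum fun k _ => ?_)
      rw [abs_mul, abs_mul, abs_of_nonneg (S_nonneg n j k)]
      exact mul_le_mul_of_nonneg_right (S_le n j k) (mul_nonneg (hf0 _) (hf0 _))
    have h2 := pow_mul_convolution_le hf0 hfs hG (n + j)
    have h3 : ((n : ℝ) + 1) ^ p ≤ (((n + j : ℕ) : ℝ) + 1) ^ p := by
      push_cast; gcongr; linarith [j.cast_nonneg (α := ℝ)]
    have h4 : 0 ≤ ∑ k ∈ Finset.range (n + j + 1), f k * f (n + j - k) :=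
      Finset.sum_nonneg fun k _ => mul_nonneg (hf0 _) (hf0 _)
    rw [abs_mul]
    calc ((n : ℝ) + 1) ^ p * (|amp x j| *
          |∑ k ∈ Finset.range (n + j + 1), S n j k * (amp x k * amp x (n + j - k))|)
        ≤ ((n : ℝ) + 1) ^ p * (f j *
          (((n : ℝ) + 1) * ∑ k ∈ Finset.range (n + j + 1), f k * f (n + j - k))) := by
          gcongr
      _ = f j * (((n : ℝ) + 1) * (((n : ℝ) + 1) ^ p *
          ∑ k ∈ Finset.range (n + j + 1), f k * f (n + j - k))) := by ring
      _ ≤ f j * (((n : ℝ) + 1) * (2 ^ (p + 1) * G * ∑' n, f n)) := by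
          refine mul_le_mul_of_nonneg_left ?_ (hf0 j)
          refine mul_le_mul_of_nonneg_left ?_ hn.le
          exact (mul_le_mul_of_nonneg_right h3 h4).trans h2
      _ = _ := by ring
  have hbd : ((n : ℝ) + 1) ^ p * |⟪cone (mode n) x, cone x x⟫_ℝ| ≤
      ((n : ℝ) + 1) * (2 ^ (p + 1) * G * ∑' n, f n) * ∑' n, f n := by
    have h1 := hrow.mul_left (((n : ℝ) + 1) ^ p)
    have h2 := hfs.hasSum.mul_left (((n : ℝ) + 1) * (2 ^ (p + 1) * G * ∑' n, f n))
    have h3 := h1.norm_le_of_bounded h2 (fun j => by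
      rw [Real.norm_eq_abs, abs_mul, abs_of_nonneg (by positivity)]
      exact hD j)
    rwa [Real.norm_eq_abs, abs_mul, abs_of_nonneg (by positivity)] at h3
  rw [hval, abs_mul, abs_mul, abs_of_pos hn] at hbd
  have hbd' : ((n : ℝ) + 1) ^ p * (|(1 + 2 * om) - ((n : ℝ) + 1) * om| * f n) ≤
      2 ^ (p + 1) * G * M ^ 2 := by
    refine le_of_mul_le_mul_left (?_ : ((n : ℝ) + 1) * _ ≤ ((n : ℝ) + 1) * _) hn
    calc _ = _ := by simp only [hf]; ring
      _ ≤ _ := hbd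
      _ = ((n : ℝ) + 1) * (2 ^ (p + 1) * G * (∑' n, f n) ^ 2) := by ring
      _ ≤ _ := by gcongr
  have h5 : ((n : ℝ) + 1) * om ≤ |(1 + 2 * om) - ((n : ℝ) + 1) * om| + (1 + 2 * om) := by
    linarith [neg_abs_le ((1 + 2 * om) - ((n : ℝ) + 1) * om)]
  have h6 := hG n
  calc om * (((n : ℝ) + 1) ^ (p + 1) * |amp x n|)
      = ((n : ℝ) + 1) ^ p * f n * (((n : ℝ) + 1) * om) := by simp only [hf]; ring
    _ ≤ ((n : ℝ) + 1) ^ p * f n * (|(1 + 2 * om) - ((n : ℝ) + 1) * om| + (1 + 2 * om)) := by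
        refine mul_le_mul_of_nonneg_left h5 (mul_nonneg (by positivity) (hf0 n))
    _ = ((n : ℝ) + 1) ^ p * (|(1 + 2 * om) - ((n : ℝ) + 1) * om| * f n) +
        (1 + 2 * om) * (((n : ℝ) + 1) ^ p * |amp x n|) := by simp only [hf]; ring
    _ ≤ 2 ^ (p + 1) * G * M ^ 2 + (1 + 2 * om) * G := by gcongr
    _ = _ := by ring

theorem exists_decay {a R : ℝ} (ha : 0 < a) (p : ℕ) :
    ∃ K, ∀ om x, IsCritical om x → a ≤ om → om ≤ R → ‖shrink x‖ ≤ R →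
      ∀ n : ℕ, ((n : ℝ) + 1) ^ p * |amp x n| ≤ K := by
  induction p with
  | zero =>
    refine ⟨R, fun om x _ _ _ hx n => ?_⟩
    rw [pow_zero, one_mul]
    exact (lp.norm_apply_le_norm (by norm_num) (shrink x) n).trans hx
  | succ p ih =>
    obtain ⟨K, hK⟩ := ih
    set M : ℝ := (((1 + 2 * R) * R / a) ^ 2 + ∑' n : ℕ, 1 / ((n : ℝ) + 1) ^ 2) / 2
    refine ⟨((1 + 2 * R) * K + 2 ^ (p + 1) * K * M ^ 2) / a, fun om x h h1 h2 h3 n => ?_⟩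
    have hom : 0 < om := ha.trans_le h1
    have hK0 : 0 ≤ K := le_trans (by positivity) (hK om x h h1 h2 h3 0)
    have hR : 0 ≤ R := (norm_nonneg _).trans h3
    have hx : ‖x‖ ≤ (1 + 2 * R) * R / a := by
      rw [le_div_iff₀ ha]
      calc ‖x‖ * a ≤ om * ‖x‖ := by rw [mul_comm]; gcongr
        _ ≤ (1 + 2 * om) * ‖shrink x‖ := h.norm_le hom
        _ ≤ (1 + 2 * R) * R := by gcongr
    have hM : ∑' n, |amp x n| ≤ M := (tsum_abs_amp_le x).trans (by
      simp only [M]; gcongr)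
    have := h.decay_succ hom (hK om x h h1 h2 h3) hM n
    rw [le_div_iff₀ ha]
    calc ((n : ℝ) + 1) ^ (p + 1) * |amp x n| * a
        ≤ ((n : ℝ) + 1) ^ (p + 1) * |amp x n| * om := by gcongr
      _ = om * (((n : ℝ) + 1) ^ (p + 1) * |amp x n|) := by ring
      _ ≤ _ := this
      _ ≤ _ := by gcongr

/-- The energy-space lift of a branch, with its first-order expansion in the energy norm. -/
theorem IsBranch.exists_lift {om₀ r : ℝ} {v : RealSeq} {om : ℝ → ℝ} {A : ℝ → RealSeq}
    (h : IsBranch om₀ (amp v) r om A) (hb : IsBifurcation om₀ v) :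
    ∃ x : ℝ → RealSeq, (∀ᶠ ε in 𝓝[≠] 0, shrink (x ε) = A ε ∧ IsCritical (om ε) (x ε) ∧
        ∃ K, ∀ n : ℕ, ((n : ℝ) + 1) ^ 4 * |amp (x ε) n| ≤ K) ∧
      Tendsto om (𝓝[≠] 0) (𝓝 om₀) ∧
      Tendsto (fun ε => ε⁻¹ • (x ε - mode 1)) (𝓝[≠] 0) (𝓝 v) := by
  have hex : ∀ ε, ∃ x, ε ∈ Set.Ioo (-r) r → shrink x = A ε := by
    intro ε
    by_cases hε : ε ∈ Set.Ioo (-r) r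
    · obtain ⟨x, hx⟩ := (finiteEnergy_iff _).1 (h.stationary ε hε).1
      exact ⟨x, fun _ => hx⟩
    · exact ⟨0, fun h => absurd h hε⟩
  choose x hx using hex
  have hIoo : ∀ᶠ ε in 𝓝 (0 : ℝ), ε ∈ Set.Ioo (-r) r :=
    Ioo_mem_nhds (neg_lt_zero.2 h.pos) h.pos
  have h0 : (0 : ℝ) ∈ Set.Ioo (-r) r := hIoo.self_of_nhds
  have hcrit : ∀ ε ∈ Set.Ioo (-r) r, IsCritical (om ε) (x ε) := by
    intro ε hε
    rw [← isStationary_shrink_iff, hx ε hε]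
    exact h.stationary ε hε
  obtain ⟨C, hC⟩ := h.bound
  have homc : ContinuousAt om 0 :=
    (h.smooth_om.contDiffAt hIoo).continuousAt
  have hom0 : om 0 = om₀ := by
    have := hC 0 h0 0
    have h1 := abs_nonneg (om 0 - om₀)
    have h2 := abs_nonneg (A 0 0 - unitSeq 1 0 - 0 * amp v 0)
    have : |om 0 - om₀| = 0 := le_antisymm (by nlinarith) h1
    linarith [abs_eq_zero.1 this]
  have homt : Tendsto om (𝓝 0) (𝓝 om₀) := by simpa [hom0] using homc.tendsto
  have hAc : ContinuousAt A 0 := (h.smooth_A.contDiffAt hIoo).continuousAt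
  set R := max (2 * om₀) (‖A 0‖ + 1)
  -- Four powers suffice for the interpolation below to leave the summable weight `1/(n+1)²`.
  obtain ⟨K, hK⟩ := exists_decay (a := om₀ / 2) (R := R) (half_pos hb.om_pos) 4
  have hev : ∀ᶠ ε in 𝓝 (0 : ℝ), ε ∈ Set.Ioo (-r) r ∧ |ε| ≤ 1 ∧
      ∀ n : ℕ, ((n : ℝ) + 1) ^ 4 * |amp (x ε) n| ≤ K := by
    have e1 : ∀ᶠ ε in 𝓝 (0 : ℝ), om₀ / 2 < om ε :=
      homt.eventually_const_lt (half_lt_self hb.om_pos)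
    have e2 : ∀ᶠ ε in 𝓝 (0 : ℝ), om ε < 2 * om₀ :=
      homt.eventually_lt_const (by linarith [hb.om_pos])
    have e3 : ∀ᶠ ε in 𝓝 (0 : ℝ), ‖A ε‖ < ‖A 0‖ + 1 :=
      hAc.norm.tendsto.eventually_lt_const (by linarith)
    have e4 : ∀ᶠ ε in 𝓝 (0 : ℝ), |ε| < 1 := by
      have : Tendsto (fun ε : ℝ => |ε|) (𝓝 0) (𝓝 0) := by
        simpa using (continuous_abs.tendsto (0 : ℝ))
      exact this.eventually_lt_const one_pos
    filter_upwards [hIoo, e1, e2, e3, e4] with ε a1 a2 a3 a4 a5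
    refine ⟨a1, a5.le, hK _ _ (hcrit ε a1) a2.le (a3.le.trans (le_max_left _ _)) ?_⟩
    rw [hx ε a1]
    exact a4.le.trans (le_max_right _ _)
  refine ⟨x, ?_, homt.mono_left nhdsWithin_le_nhds, ?_⟩
  · filter_upwards [hev.filter_mono nhdsWithin_le_nhds] with ε hε
    exact ⟨hx ε hε.1, hcrit ε hε.1, K, hε.2.2⟩
  obtain ⟨V, hV⟩ := hb.decay
  have hV0 : 0 ≤ V := le_trans (by positivity) (hV 0)
  have hrem : ∀ ε : ℝ, ε ≠ 0 → ∀ n : ℕ, (ε⁻¹ • (x ε - mode 1) - v : RealSeq) n =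
      ((n : ℝ) + 1) * (ε⁻¹ * (amp (x ε) n - unitSeq 1 n - ε * amp v n)) := by
    intro ε hε n
    rw [← mul_amp, amp_sub, amp_smul, amp_sub, amp_mode]
    field_simp
  -- For the remainder `ρ` at index `n`, the branch bound gives `ρ ≤ C ε²` and decay gives `(n+1)^4
  -- ρ ≤ K + 16 + V`. The first yields termwise convergence; the product of the two dominates
  -- `(n+1)² ρ² / ε²` uniformly in `ε`.
  have hkey : Tendsto (fun ε => ∑' n : ℕ, (ε⁻¹ • (x ε - mode 1) - v : RealSeq) n ^ 2)
      (𝓝[≠] 0) (𝓝 (∑' _ : ℕ, 0)) := by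
    have hev' : ∀ᶠ ε in 𝓝[≠] (0 : ℝ), ε ≠ 0 ∧ ∀ n : ℕ,
        |amp (x ε) n - unitSeq 1 n - ε * amp v n| ≤ C * ε ^ 2 ∧
        ((n : ℝ) + 1) ^ 4 * |amp (x ε) n - unitSeq 1 n - ε * amp v n| ≤ K + 16 + V := by
      filter_upwards [hev.filter_mono nhdsWithin_le_nhds, self_mem_nhdsWithin] with ε hε hne
      refine ⟨hne, fun n => ⟨?_, ?_⟩⟩
      · have := hC ε hε.1 n
        rw [← hx ε hε.1, shrink_apply] at this
        linarith [abs_nonneg (om ε - om₀)]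
      · have h1 : ((n : ℝ) + 1) ^ 4 * |unitSeq 1 n| ≤ 16 := by
          by_cases hn : n = 1
          · subst hn; norm_num [unitSeq]
          · simp [unitSeq, hn]
        have h2 : |amp (x ε) n - unitSeq 1 n - ε * amp v n| ≤
            |amp (x ε) n| + |unitSeq 1 n| + |amp v n| := by
          refine (abs_sub _ _).trans (add_le_add (abs_sub _ _) ?_)
          rw [abs_mul]
          exact mul_le_of_le_one_left (abs_nonneg _) hε.2.1
        calc _ ≤ ((n : ℝ) + 1) ^ 4 * (|amp (x ε) n| + |unitSeq 1 n| + |amp v n|) := by gcongr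
          _ ≤ _ := by linarith [hε.2.2 n, hV n]
    refine tendsto_tsum_of_dominated_convergence
      (bound := fun n : ℕ => C * (K + 16 + V) * (1 / ((n : ℝ) + 1) ^ 2))
      (summable_inv_sq.mul_left _) (fun n => ?_) ?_
    · have hz : Tendsto (fun ε : ℝ => ((n : ℝ) + 1) ^ 2 * C ^ 2 * ε ^ 2) (𝓝[≠] 0) (𝓝 0) := by
        have : Continuous fun ε : ℝ => ((n : ℝ) + 1) ^ 2 * C ^ 2 * ε ^ 2 := by fun_prop
        have := this.tendsto 0
        simp only [ne_eq, OfNat.ofNat_ne_zero, not_false_eq_true, zero_pow, mul_zero] at this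
        exact this.mono_left nhdsWithin_le_nhds
      refine squeeze_zero' (Eventually.of_forall fun _ => sq_nonneg _) ?_ hz
      filter_upwards [hev'] with ε hε
      rw [hrem ε hε.1, mul_pow, mul_pow, mul_assoc]
      refine mul_le_mul_of_nonneg_left ?_ (sq_nonneg _)
      have h1 := (hε.2 n).1
      have h2 : (amp (x ε) n - unitSeq 1 n - ε * amp v n) ^ 2 ≤ (C * ε ^ 2) ^ 2 := by
        rw [← sq_abs]
        exact pow_le_pow_left₀ (abs_nonneg _) h1 2
      calc _ ≤ ε⁻¹ ^ 2 * (C * ε ^ 2) ^ 2 := by gcongr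
        _ = _ := by have := hε.1; field_simp
    · filter_upwards [hev'] with ε hε n
      rw [hrem ε hε.1, Real.norm_eq_abs, abs_of_nonneg (sq_nonneg _), ← sq_abs, abs_mul, abs_mul,
        abs_of_nonneg (by positivity : (0 : ℝ) ≤ (n : ℝ) + 1)]
      obtain ⟨h1, h2⟩ := hε.2 n
      set ρ := |amp (x ε) n - unitSeq 1 n - ε * amp v n|
      have hρ : 0 ≤ ρ := abs_nonneg _
      have hn : (0 : ℝ) < (n : ℝ) + 1 := by positivity
      have hε2 : 0 < ε ^ 2 := by have := hε.1; positivity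
      have h3 : |ε⁻¹| ^ 2 * ρ ≤ C := by
        rw [sq_abs, inv_pow, inv_mul_le_iff₀ hε2]
        linarith
      have h4 : ((n : ℝ) + 1) ^ 2 * ρ ≤ (K + 16 + V) * (1 / ((n : ℝ) + 1) ^ 2) := by
        rw [mul_one_div, le_div_iff₀ (by positivity)]
        linarith
      calc (((n : ℝ) + 1) * (|ε⁻¹| * ρ)) ^ 2
          = (|ε⁻¹| ^ 2 * ρ) * (((n : ℝ) + 1) ^ 2 * ρ) := by ring
        _ ≤ C * ((K + 16 + V) * (1 / ((n : ℝ) + 1) ^ 2)) := by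
            refine mul_le_mul h3 h4 (by positivity) (le_trans (by positivity) h3)
        _ = _ := by ring
  rw [tendsto_iff_norm_sub_tendsto_zero]
  rw [tsum_zero] at hkey
  have := (Real.continuous_sqrt.tendsto 0).comp hkey
  rw [Real.sqrt_zero] at this
  refine this.congr fun ε => ?_
  rw [Function.comp_apply, (hasSum_sq _).tsum_eq, Real.sqrt_sq (norm_nonneg _)]

/-! ### Coercivity along a branch -/

theorem continuous_hessForm (s : ℝ) :
    Continuous fun p : ℝ × RealSeq => hessForm s p.1 p.2 := by
  have h1 : Continuous fun p : ℝ × RealSeq =>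
      (ip ConeSeq).bilinearComp (cone p.2) (cone p.2) := by
    have hc : Continuous fun p : ℝ × RealSeq => cone p.2 := by fun_prop
    have hf : Continuous fun p : ℝ × RealSeq => ((ip ConeSeq).comp (cone p.2)).flip :=
      (ContinuousLinearMap.flipₗᵢ ℝ RealSeq ConeSeq ℝ).continuous.comp
        (continuous_const.clm_comp hc)
    exact (ContinuousLinearMap.flipₗᵢ ℝ RealSeq RealSeq ℝ).continuous.comp (hf.clm_comp hc)
  have h2 : Continuous fun p : ℝ × RealSeq =>
      (ContinuousLinearMap.compL ℝ RealSeq ConeSeq ℝ (ip ConeSeq (cone p.2 p.2))).comp cone := by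
    have hc : Continuous fun p : ℝ × RealSeq => cone p.2 p.2 := by fun_prop
    exact ((ContinuousLinearMap.compL ℝ RealSeq ConeSeq ℝ).continuous.comp
      ((ip ConeSeq).continuous.comp hc)).clm_comp continuous_const
  have h3 : Continuous fun p : ℝ × RealSeq => 1 + 2 * p.1 := by fun_prop
  exact (((h1.const_smul (2 : ℝ)).add (h2.const_smul s)).sub (h3.smul continuous_const)).add
    (continuous_fst.smul continuous_const)

/-- Coercivity modulo one functional survives small changes of the form and of the functional, at
the price of half the constant `c` and twice `C`. -/
theorem quadratic_perturb {c C η F₀ F a b t : ℝ} (hC : 0 ≤ C)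
    (h : c * t ^ 2 ≤ F₀ + C * a ^ 2) (hF : |F - F₀| ≤ c / 4 * t ^ 2) (hab : |a - b| ≤ η * t)
    (hη : 2 * C * η ^ 2 ≤ c / 4) : c / 2 * t ^ 2 ≤ F + 2 * C * b ^ 2 := by
  have h1 : (a - b) ^ 2 ≤ (η * t) ^ 2 := by
    rw [← sq_abs]; exact pow_le_pow_left₀ (abs_nonneg _) hab 2
  have h2 : a ^ 2 ≤ 2 * b ^ 2 + 2 * (η * t) ^ 2 := by nlinarith [sq_nonneg (a - 2 * b)]
  have h3 := mul_le_mul_of_nonneg_left h2 hC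
  have h4 := mul_le_mul_of_nonneg_right hη (sq_nonneg t)
  nlinarith [neg_abs_le (F - F₀)]

theorem eventually_bilin_close {F ι : Type*} [NormedAddCommGroup F] [NormedSpace ℝ F]
    {l : Filter ι} {B : ι → F →L[ℝ] F →L[ℝ] ℝ} {B₀ : F →L[ℝ] F →L[ℝ] ℝ}
    (h : Tendsto B l (𝓝 B₀)) {c : ℝ} (hc : 0 < c) :
    ∀ᶠ i in l, ∀ u, |B i u u - B₀ u u| ≤ c * ‖u‖ ^ 2 := by
  have h1 := (tendsto_iff_norm_sub_tendsto_zero (E := F →L[ℝ] F →L[ℝ] ℝ)).1 h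
  filter_upwards [h1.eventually_lt_const hc] with i hi u
  have := (B i - B₀).le_opNorm₂ u u
  simp only [sub_apply, Real.norm_eq_abs] at this
  nlinarith [mul_le_mul_of_nonneg_right hi.le (sq_nonneg ‖u‖)]

section Branch

variable {om₀ : ℝ} {v : RealSeq} {om : ℝ → ℝ} {x : ℝ → RealSeq}

theorem tendsto_mode_one
    (hx : Tendsto (fun ε => ε⁻¹ • (x ε - mode 1)) (𝓝[≠] 0) (𝓝 v)) :
    Tendsto x (𝓝[≠] 0) (𝓝 (mode 1)) := by
  have h1 : Tendsto (fun ε : ℝ => ε) (𝓝[≠] 0) (𝓝 0) := tendsto_id.mono_left nhdsWithin_le_nhds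
  have h2 := (h1.smul hx).add_const (mode 1)
  rw [zero_smul, zero_add] at h2
  refine h2.congr' ?_
  filter_upwards [self_mem_nhdsWithin] with ε hε
  rw [smul_inv_smul₀ hε, sub_add_cancel]

theorem eventually_hessForm_close (s : ℝ) (hom : Tendsto om (𝓝[≠] 0) (𝓝 om₀))
    (hx : Tendsto (fun ε => ε⁻¹ • (x ε - mode 1)) (𝓝[≠] 0) (𝓝 v)) {c : ℝ} (hc : 0 < c) :
    ∀ᶠ ε in 𝓝[≠] 0, ∀ u, |hessForm s (om ε) (x ε) u u - hessForm s om₀ (mode 1) u u| ≤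
      c * ‖u‖ ^ 2 :=
  eventually_bilin_close (((continuous_hessForm s).tendsto (om₀, mode 1)).comp
    (hom.prodMk_nhds (tendsto_mode_one hx))) hc

theorem exists_small_sq {c C : ℝ} (hc : 0 < c) (hC : 0 ≤ C) :
    ∃ η > 0, 2 * C * η ^ 2 ≤ c / 4 := by
  refine ⟨Real.sqrt (c / (8 * (C + 1))), Real.sqrt_pos.2 (by positivity), ?_⟩
  rw [Real.sq_sqrt (by positivity), mul_div_assoc', div_le_iff₀ (by positivity)]
  nlinarith

theorem eventually_clm_close (B : RealSeq →L[ℝ] RealSeq →L[ℝ] ℝ) {y : ℝ → RealSeq}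
    {w : RealSeq} (hy : Tendsto y (𝓝[≠] 0) (𝓝 w)) {η : ℝ} (hη : 0 < η) :
    ∀ᶠ ε in 𝓝[≠] 0, ∀ u, |B w u - B (y ε) u| ≤ η * ‖u‖ := by
  have h1 := (B.continuous.tendsto w).comp hy
  rw [tendsto_iff_norm_sub_tendsto_zero] at h1
  filter_upwards [h1.eventually_lt_const hη] with ε hε u
  rw [← sub_apply, ← Real.norm_eq_abs]
  refine (ContinuousLinearMap.le_opNorm _ _).trans (mul_le_mul_of_nonneg_right ?_ (norm_nonneg _))
  rw [norm_sub_rev]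
  exact hε.le

/-- The functional `disp v` is the limit of `disp (ε⁻¹ • (x ε - mode 1))`, which equals `ε⁻¹` times
a combination of the two constraints because `disp (mode 1) = 0`. The resulting `C` depends on `ε`,
which is harmless. -/
theorem IsBifurcation.eventually_plus (hb : IsBifurcation om₀ v)
    (hom : Tendsto om (𝓝[≠] 0) (𝓝 om₀))
    (hx : Tendsto (fun ε => ε⁻¹ • (x ε - mode 1)) (𝓝[≠] 0) (𝓝 v)) :
    ∀ᶠ ε in 𝓝[≠] 0, ∃ c > 0, ∃ C ≥ 0, ∀ u, c * ‖u‖ ^ 2 ≤ hessForm 1 (om ε) (x ε) u u +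
      C * (⟪shrink (x ε), u⟫_ℝ ^ 2 + ⟪x ε, u⟫_ℝ ^ 2) := by
  obtain ⟨c, hc, C, hC, h⟩ := hb.plus
  obtain ⟨η, hη, hηC⟩ := exists_small_sq hc hC
  filter_upwards [eventually_hessForm_close 1 hom hx (c := c / 4) (by positivity),
    eventually_clm_close disp hx hη] with ε h1 h2
  refine ⟨c / 2, half_pos hc, 2 * C * (ε⁻¹ ^ 2 * 8), by positivity, fun u => ?_⟩
  have h3 := quadratic_perturb hC (h u) (h1 u) (h2 u) hηC
  have h4 : disp (ε⁻¹ • (x ε - mode 1)) u = ε⁻¹ * (⟪x ε, u⟫_ℝ - 2 * ⟪shrink (x ε), u⟫_ℝ) := by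
    rw [map_smul, map_sub, smul_apply, sub_apply, disp_mode_one, disp_apply, smul_eq_mul, sub_zero]
  rw [h4, mul_pow] at h3
  have h5 : (⟪x ε, u⟫_ℝ - 2 * ⟪shrink (x ε), u⟫_ℝ) ^ 2 ≤
      8 * (⟪shrink (x ε), u⟫_ℝ ^ 2 + ⟪x ε, u⟫_ℝ ^ 2) := by
    nlinarith [sq_nonneg (⟪x ε, u⟫_ℝ + 2 * ⟪shrink (x ε), u⟫_ℝ), sq_nonneg ⟪x ε, u⟫_ℝ]
  have h6 := mul_le_mul_of_nonneg_left h5 (by positivity : 0 ≤ 2 * C * ε⁻¹ ^ 2)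
  linarith

theorem IsBifurcation.eventually_minus (hb : IsBifurcation om₀ v)
    (hom : Tendsto om (𝓝[≠] 0) (𝓝 om₀))
    (hx : Tendsto (fun ε => ε⁻¹ • (x ε - mode 1)) (𝓝[≠] 0) (𝓝 v)) :
    ∀ᶠ ε in 𝓝[≠] 0, ∃ c > 0, ∃ C ≥ 0, ∀ u, c * ‖u‖ ^ 2 ≤ hessForm (-1) (om ε) (x ε) u u +
      C * (⟪shrink (x ε), shrink u⟫_ℝ ^ 2 + ⟪shrink (x ε), u⟫_ℝ ^ 2) := by
  obtain ⟨c, hc, C, hC, h⟩ := hb.minus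
  obtain ⟨η₁, hη₁, hηC₁⟩ := exists_small_sq hc hC
  obtain ⟨η₂, hη₂, hηC₂⟩ := exists_small_sq (half_pos hc) hC
  filter_upwards [eventually_hessForm_close (-1) hom hx (c := c / 4) (by positivity),
    eventually_clm_close dispMinus hx hη₁,
    eventually_clm_close ((ip RealSeq).bilinearComp shrink shrink) (tendsto_mode_one hx) hη₂]
    with ε h1 h2 h2'
  refine ⟨c / 4, by positivity, 2 * C + 2 * C * (ε⁻¹ ^ 2 * 8), by positivity, fun u => ?_⟩
  -- The two detecting functionals are replaced one after the other: `dispMinus v` here, with `amp u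
  -- 1` absorbed into the form, and `amp u 1` in `h3'`.
  have h3 := quadratic_perturb (F₀ := hessForm (-1) om₀ (mode 1) u u + C * amp u 1 ^ 2)
    (F := hessForm (-1) (om ε) (x ε) u u + C * amp u 1 ^ 2) hC
    ((h u).trans_eq (by ring)) (by simpa using h1 u) (h2 u) hηC₁
  have h2u := h2' u
  simp only [ContinuousLinearMap.bilinearComp_apply, ip_apply, inner_shrink_mode_one] at h2u
  have h3' := quadratic_perturb (F₀ := hessForm (-1) (om ε) (x ε) u u +
      2 * C * dispMinus (ε⁻¹ • (x ε - mode 1)) u ^ 2)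
    (F := hessForm (-1) (om ε) (x ε) u u +
      2 * C * dispMinus (ε⁻¹ • (x ε - mode 1)) u ^ 2) hC
    (h3.trans_eq (by ring)) (by simp; positivity) h2u hηC₂
  have h4 : dispMinus (ε⁻¹ • (x ε - mode 1)) u =
      ε⁻¹ * (⟪shrink (x ε), u⟫_ℝ - 2 * ⟪shrink (x ε), shrink u⟫_ℝ) := by
    rw [map_smul, map_sub, smul_apply, sub_apply, dispMinus_mode_one, dispMinus_apply, smul_eq_mul,
      sub_zero]
  rw [h4, mul_pow] at h3'
  have h5 : (⟪shrink (x ε), u⟫_ℝ - 2 * ⟪shrink (x ε), shrink u⟫_ℝ) ^ 2 ≤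
      8 * (⟪shrink (x ε), shrink u⟫_ℝ ^ 2 + ⟪shrink (x ε), u⟫_ℝ ^ 2) := by
    nlinarith [sq_nonneg (⟪shrink (x ε), u⟫_ℝ + 2 * ⟪shrink (x ε), shrink u⟫_ℝ),
      sq_nonneg ⟪shrink (x ε), u⟫_ℝ]
  have h6 := mul_le_mul_of_nonneg_left h5 (by positivity : 0 ≤ 2 * C * ε⁻¹ ^ 2)
  have h7 : 0 ≤ 2 * C * ⟪shrink (x ε), u⟫_ℝ ^ 2 := by positivity
  linarith

end Branch

/-! ### The kernel of `L_-` -/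

/-- Infinitesimal invariance under the global phase: for `s = -1` the form at `(x, w)` is the
Euler–Lagrange equation itself. -/
theorem IsCritical.hessForm_self {om : ℝ} {x : RealSeq} (h : IsCritical om x) (w : RealSeq) :
    hessForm (-1) om x x w = 0 := by
  have := h w
  rw [hessForm_apply]
  linarith

/-- `M` acts as a derivation on the convolution: the weights `p+i+1` and `p+i'+1` add up to
`2p+q+2`, constant on each antidiagonal. -/
theorem conv_leibniz (y m : RealSeq) (z : ℕ × ℕ) :
    cone y (shrink m) z + cone (shrink y) m z =
      (2 * (z.1 : ℝ) + z.2 + 2) * cone (shrink y) (shrink m) z := by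
  simp only [cone_apply, conv]
  rw [← Finset.sum_add_distrib, Finset.mul_sum]
  refine Finset.sum_congr rfl fun i hi => ?_
  have hq : (z.2 : ℝ) = i.1 + i.2 := by
    exact_mod_cast (Finset.HasAntidiagonal.mem_antidiagonal.1 hi).symm
  have e1 : amp y (z.1 + i.1) = (((z.1 + i.1 : ℕ) : ℝ) + 1) * amp (shrink y) (z.1 + i.1) := by
    rw [mul_amp, shrink_apply]
  have e2 : amp m (z.1 + i.2) = (((z.1 + i.2 : ℕ) : ℝ) + 1) * amp (shrink m) (z.1 + i.2) := by
    rw [mul_amp, shrink_apply]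
  rw [e1, e2, hq]
  push_cast
  ring

theorem inner_leibniz (y m : RealSeq) :
    ⟪cone y (shrink m) + cone (shrink y) m, cone (shrink m) (shrink m)⟫_ℝ =
      2 * ⟪cone (shrink y) (shrink m), cone (shrink m) m⟫_ℝ := by
  have h : (2 : ℝ) * ⟪cone (shrink y) (shrink m), cone (shrink m) m⟫_ℝ =
      ⟪cone (shrink y) (shrink m), cone m (shrink m) + cone (shrink m) m⟫_ℝ := by
    rw [cone_comm m (shrink m), inner_add_right]; ring
  rw [h, ← (hasSum_mul _ _).tsum_eq, ← (hasSum_mul _ _).tsum_eq]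
  refine tsum_congr fun z => ?_
  rw [lp.coeFn_add, lp.coeFn_add, Pi.add_apply, Pi.add_apply, conv_leibniz, conv_leibniz]
  ring

theorem shrink_mode (n : ℕ) : shrink (((n : ℝ) + 1) • mode n) = mode n := by
  ext m
  have hn : (n : ℝ) + 1 ≠ 0 := by positivity
  rw [shrink_apply, amp_smul, amp_mode]
  by_cases h : m = n
  · subst h; simp [unitSeq, mode]
  · simp [unitSeq, mode, h]

/-- Infinitesimal invariance under the second phase rotation: `m` is the lift of `MA`. The Leibniz
rule compares its form with the Euler–Lagrange equation tested at `y`, where the test vector is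
`shrink y`. -/
theorem IsCritical.hessForm_shrink {om : ℝ} {m : RealSeq} (h : IsCritical om (shrink m))
    (w : RealSeq) : hessForm (-1) om (shrink m) m w = 0 := by
  suffices hessForm (-1) om (shrink m) m = 0 by rw [this, zero_apply]
  refine eq_zero_of_mode _ fun n => ?_
  rw [← shrink_mode n]
  set y := ((n : ℝ) + 1) • mode n
  have h1 := inner_leibniz y m
  have h2 := h y
  rw [hessForm_apply, cone_comm m (shrink y), cone_comm (shrink m) (shrink y), ← inner_shrink_comm m y,
    ← inner_shrink_comm (shrink m) y, real_inner_comm, real_inner_comm _ (cone (shrink m) (shrink m))]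
  rw [inner_add_left, cone_comm y, real_inner_comm] at h1
  linarith

/-! ### The operators `L_±` -/

theorem cardinal_sum_eq_zero {ι : Type*} {f : ι → Cardinal} (h : ∀ i, f i = 0) :
    Cardinal.sum f = 0 := by
  rw [show f = fun _ => 0 from funext h]
  simp

section Operators

variable {s om : ℝ} {x : RealSeq}

theorem hasSum_hessTerm (s : ℝ) (x u : RealSeq) (n : ℕ) :
    HasSum (hessTerm s (shrink x) (shrink u) n)
      (2 * ⟪cone (mode n) x, cone u x⟫_ℝ + s * ⟪cone (mode n) u, cone x x⟫_ℝ) := by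
  convert! ((hasSum_row n x u x).mul_left 2).add ((hasSum_row n u x x).mul_left s) using 2 with j
  simp only [hessTerm, Finset.mul_sum, ← Finset.sum_add_distrib, shrink_apply]
  exact Finset.sum_congr rfl fun k _ => by ring

theorem hessSeq_shrink (s om : ℝ) (x u : RealSeq) (n : ℕ) :
    hessSeq s (1 + om) om (shrink x) (shrink u) n = hessForm s om x u (mode n) := by
  rw [hessSeq, (hasSum_hessTerm s x u n).tsum_eq, hessForm_apply, cone_comm u (mode n),
    cone_comm x (mode n), real_inner_comm (mode n), real_inner_comm (mode n), inner_mode,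
    inner_mode, shrink_apply, cone_comm u x, real_inner_comm (cone x u),
    real_inner_comm (cone x x), ← mul_amp u n]
  ring

theorem inner_single_one (n : ℕ) (a : RealSeq) : ⟪a, shrink (mode n)⟫_ℝ = a n := by
  rw [← inner_shrink_comm, real_inner_comm, inner_mode, shrink_apply, mul_amp]

theorem inner_eq_hessForm {u L : RealSeq}
    (h : ∀ n, L n = hessSeq s (1 + om) om (shrink x) (shrink u) n) (w : RealSeq) :
    ⟪L, shrink w⟫_ℝ = hessForm s om x u w := by
  have h1 : (ip RealSeq L).comp shrink - hessForm s om x u = 0 :=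
    eq_zero_of_mode _ fun n => by
      rw [sub_apply, ContinuousLinearMap.comp_apply, ip_apply, inner_single_one, h,
        hessSeq_shrink, sub_self]
  have h2 := congrArg (fun f : RealSeq →L[ℝ] ℝ => f w) h1
  simpa [sub_eq_zero] using h2

/-- In the first part of each term `S ≤ j + 1` is absorbed by the decay of `x` at `j`; in the second
`S ≤ n + j + 1` is absorbed by the decay of the convolution of `x` with itself. Only boundedness of
`a` is needed. -/
theorem exists_hessTerm_bound {K : ℝ} (hK : ∀ n : ℕ, ((n : ℝ) + 1) ^ 4 * |amp x n| ≤ K)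
    (s : ℝ) (a : RealSeq) :
    ∃ B, ∀ n, |∑' j, hessTerm s (shrink x) a n j| ≤ B := by
  set f : ℕ → ℝ := fun n => |amp x n| with hf
  have hf0 : ∀ n, 0 ≤ f n := fun n => abs_nonneg _
  have hfs : Summable f := summable_abs_amp x
  set M := ∑' n, f n
  have hM0 : 0 ≤ M := tsum_nonneg hf0
  have hK0 : 0 ≤ K := le_trans (by positivity) (hK 0)
  have ha : ∀ n, |a n| ≤ ‖a‖ := fun n => lp.norm_apply_le_norm (by norm_num) a n
  set D : ℝ := 2 * (K * M * ‖a‖) + |s| * (2 ^ (4 + 1) * K * M * ‖a‖) with hD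
  have hterm : ∀ n j, ‖hessTerm s (shrink x) a n j‖ ≤ D * (1 / ((j : ℝ) + 1) ^ 2) := by
    intro n j
    have hj : (1 : ℝ) ≤ (j : ℝ) + 1 := by linarith [j.cast_nonneg (α := ℝ)]
    have hpt : ∀ k ∈ Finset.range (n + j + 1),
        ‖S n j k * (2 * shrink x j * shrink x (n + j - k) * a k +
          s * (shrink x k * shrink x (n + j - k) * a j))‖ ≤
        2 * (((j : ℝ) + 1) * f j * ‖a‖) * f (n + j - k) +
          |s| * (((n + j : ℕ) : ℝ) + 1) * ‖a‖ * (f k * f (n + j - k)) := by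
      intro k hk
      have hk' : k ≤ n + j := by simp at hk; omega
      have hS1 : S n j k ≤ (j : ℝ) + 1 := by
        rw [S]
        have : min (min n j) (min k (n + j - k)) + 1 ≤ j + 1 := by omega
        exact_mod_cast this
      have hS2 : S n j k ≤ ((n + j : ℕ) : ℝ) + 1 := by
        rw [S]
        have : min (min n j) (min k (n + j - k)) + 1 ≤ n + j + 1 := by omega
        exact_mod_cast this
      rw [Real.norm_eq_abs, mul_add]
      refine (abs_add_le _ _).trans (add_le_add ?_ ?_)
      · rw [abs_mul, abs_mul, abs_mul, abs_mul, abs_of_nonneg (S_nonneg n j k),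
          abs_of_pos (two_pos (α := ℝ))]
        calc S n j k * (2 * |shrink x j| * |shrink x (n + j - k)| * |a k|)
            ≤ ((j : ℝ) + 1) * (2 * f j * f (n + j - k) * ‖a‖) := by
              refine mul_le_mul hS1 ?_ (by positivity) (by positivity)
              exact mul_le_mul_of_nonneg_left (ha k) (by positivity)
          _ = _ := by ring
      · rw [abs_mul, abs_mul, abs_mul, abs_mul, abs_of_nonneg (S_nonneg n j k)]
        calc S n j k * (|s| * (|shrink x k| * |shrink x (n + j - k)| * |a j|))
            ≤ (((n + j : ℕ) : ℝ) + 1) * (|s| * (f k * f (n + j - k) * ‖a‖)) := by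
              refine mul_le_mul hS2 ?_ (by positivity) (by positivity)
              refine mul_le_mul_of_nonneg_left ?_ (abs_nonneg s)
              exact mul_le_mul_of_nonneg_left (ha j) (by positivity)
          _ = _ := by ring
    have hpart : ∑ k ∈ Finset.range (n + j + 1), f (n + j - k) ≤ M := by
      have := Finset.sum_range_reflect f (n + j + 1)
      simp only [Nat.add_sub_cancel] at this
      rw [this]
      exact hfs.sum_le_tsum _ fun n _ => hf0 n
    have hconv := pow_mul_convolution_le hf0 hfs hK (n + j)
    have hfj : ((j : ℝ) + 1) * f j ≤ K * (1 / ((j : ℝ) + 1) ^ 2) := by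
      rw [mul_one_div, le_div_iff₀ (by positivity)]
      calc ((j : ℝ) + 1) * f j * ((j : ℝ) + 1) ^ 2 = ((j : ℝ) + 1) ^ 3 * f j := by ring
        _ ≤ ((j : ℝ) + 1) ^ 4 * f j :=
            mul_le_mul_of_nonneg_right (pow_le_pow_right₀ hj (by norm_num)) (hf0 j)
        _ ≤ K := hK j
    have hcv : (((n + j : ℕ) : ℝ) + 1) * ∑ k ∈ Finset.range (n + j + 1), f k * f (n + j - k) ≤
        2 ^ (4 + 1) * K * M * (1 / ((j : ℝ) + 1) ^ 2) := by
      set N : ℝ := ((n + j : ℕ) : ℝ) + 1 with hN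
      have hjN : (j : ℝ) + 1 ≤ N := by
        rw [hN]; push_cast; linarith [n.cast_nonneg (α := ℝ)]
      have h0 : 0 ≤ ∑ k ∈ Finset.range (n + j + 1), f k * f (n + j - k) :=
        Finset.sum_nonneg fun k _ => mul_nonneg (hf0 _) (hf0 _)
      rw [mul_one_div, le_div_iff₀ (by positivity)]
      set conv₀ := ∑ k ∈ Finset.range (n + j + 1), f k * f (n + j - k)
      calc N * conv₀ * ((j : ℝ) + 1) ^ 2 ≤ N * conv₀ * N ^ 2 := by gcongr
        _ = N ^ 3 * conv₀ := by ring
        _ ≤ N ^ 4 * conv₀ := mul_le_mul_of_nonneg_right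
            (pow_le_pow_right₀ (hj.trans hjN) (by norm_num)) h0
        _ ≤ _ := hconv
    rw [hessTerm]
    refine (norm_sum_le _ _).trans ((Finset.sum_le_sum hpt).trans ?_)
    rw [Finset.sum_add_distrib, ← Finset.mul_sum, ← Finset.mul_sum]
    have t1 : 2 * (((j : ℝ) + 1) * f j * ‖a‖) * ∑ k ∈ Finset.range (n + j + 1), f (n + j - k) ≤
        2 * (K * (1 / ((j : ℝ) + 1) ^ 2) * ‖a‖) * M := by gcongr
    have t2 := mul_le_mul_of_nonneg_left hcv (mul_nonneg (abs_nonneg s) (norm_nonneg a))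
    rw [hD]
    calc _ ≤ 2 * (K * (1 / ((j : ℝ) + 1) ^ 2) * ‖a‖) * M +
          |s| * ‖a‖ * (2 ^ (4 + 1) * K * M * (1 / ((j : ℝ) + 1) ^ 2)) := by
          refine add_le_add t1 (le_trans (le_of_eq ?_) t2)
          ring
      _ = _ := by ring
  refine ⟨∑' j : ℕ, D * (1 / ((j : ℝ) + 1) ^ 2), fun n => ?_⟩
  exact tsum_of_norm_bounded (summable_inv_sq.mul_left D).hasSum (hterm n)

/-- Elliptic regularity for the maximal domain: dividing `L_± a` by `n + 1` expresses `om (n+1) a_n`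
through square-summable sequences, so `a` has finite energy and `hessForm` applies. -/
theorem exists_shrink_of_mem_domain {K : ℝ} (hom : 0 < om)
    (hK : ∀ n : ℕ, ((n : ℝ) + 1) ^ 4 * |amp x n| ≤ K)
    (a : (hessOp s (1 + om) om (shrink x)).domain) : ∃ u, shrink u = (a : RealSeq) := by
  obtain ⟨B, hB⟩ := exists_hessTerm_bound hK s (a : RealSeq)
  have hmem : Memℓp (fun n : ℕ => (∑' j, hessTerm s (shrink x) (a : RealSeq) n j) /
      ((n : ℝ) + 1)) 2 := by
    refine memlp_two_iff.2 (Summable.of_nonneg_of_le (fun _ => sq_nonneg _) (fun n => ?_)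
      (summable_inv_sq.mul_left (B ^ 2)))
    rw [div_pow, mul_one_div, ← sq_abs]
    have := hB n
    gcongr
  set Nl : RealSeq := ⟨_, hmem⟩ with hNl
  set La : RealSeq := hessOp s (1 + om) om (shrink x) a with hLa
  have hLn : ∀ n : ℕ, La n = (∑' j, hessTerm s (shrink x) (a : RealSeq) n j) -
      ((n : ℝ) + 1) * (1 + om - n * om) * (a : RealSeq) n := fun n => rfl
  refine ⟨om⁻¹ • ((1 + 2 * om) • (a : RealSeq) - Nl + shrink La), ?_⟩
  ext n
  have hn : (n : ℝ) + 1 ≠ 0 := by positivity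
  have hNn : Nl n = (∑' j, hessTerm s (shrink x) (a : RealSeq) n j) / ((n : ℝ) + 1) := rfl
  rw [shrink_apply, amp_smul, amp]
  simp only [lp.coeFn_add, lp.coeFn_sub, lp.coeFn_smul, Pi.add_apply, Pi.sub_apply, Pi.smul_apply,
    smul_eq_mul, shrink_apply, amp, hLn, hNn]
  field_simp
  ring

theorem hessOp_inner {u : RealSeq} {a : (hessOp s (1 + om) om (shrink x)).domain}
    (hu : shrink u = (a : RealSeq)) (w : RealSeq) :
    ⟪hessOp s (1 + om) om (shrink x) a, shrink w⟫_ℝ = hessForm s om x u w := by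
  refine inner_eq_hessForm (fun n => ?_) w
  rw [hu]
  rfl

/-! ### Absence of negative eigenvalues -/

theorem mem_annihilator_iff_mul {u : RealSeq} :
    shrink u ∈ annihilator (fun n => ((n : ℝ) + 1) * (shrink x) n) ↔ ⟪x, shrink u⟫_ℝ = 0 := by
  have h : HasSum (fun n : ℕ => ((n : ℝ) + 1) * (shrink x) n * (shrink u) n) ⟪x, shrink u⟫_ℝ := by
    convert! hasSum_mul x (shrink u) using 2 with n
    rw [shrink_apply, mul_amp]
  exact ⟨fun h' => h.unique h', fun h' => by rw [h'] at h; exact h⟩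

theorem mem_annihilator_iff_sq_mul {u : RealSeq} :
    shrink u ∈ annihilator (fun n => ((n : ℝ) + 1) ^ 2 * (shrink x) n) ↔ ⟪x, u⟫_ℝ = 0 := by
  have h : HasSum (fun n : ℕ => ((n : ℝ) + 1) ^ 2 * (shrink x) n * (shrink u) n) ⟪x, u⟫_ℝ := by
    convert! hasSum_mul x u using 2 with n
    rw [← mul_amp x, ← mul_amp u, shrink_apply, shrink_apply]
    ring
  exact ⟨fun h' => h.unique h', fun h' => by rw [h'] at h; exact h⟩

theorem numNegConstrained_LPlus {K c C : ℝ} (hom : 0 < om)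
    (hK : ∀ n : ℕ, ((n : ℝ) + 1) ^ 4 * |amp x n| ≤ K) (hc : 0 < c)
    (h : ∀ u, c * ‖u‖ ^ 2 ≤ hessForm 1 om x u u +
      C * (⟪shrink x, u⟫_ℝ ^ 2 + ⟪x, u⟫_ℝ ^ 2)) :
    numNegConstrained (LPlus (1 + om) om (shrink x)) (constrainedSpace (shrink x)) = 0 := by
  rw [numNegConstrained]
  refine cardinal_sum_eq_zero fun μ => ?_
  suffices hbot : constrainedEigenspace (LPlus (1 + om) om (shrink x))
      (constrainedSpace (shrink x)) μ = ⊥ by rw [hbot]; exact rank_bot ℝ RealSeq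
  rw [eq_bot_iff]
  rintro b ⟨⟨a, ha, rfl⟩, hbW⟩
  have haW : (a : RealSeq) ∈ constrainedSpace (shrink x) := hbW
  obtain ⟨u, hu⟩ := exists_shrink_of_mem_domain hom hK a
  have h1 : ⟪(a : RealSeq), hessOp 1 (1 + om) om (shrink x) a - (μ : ℝ) • (a : RealSeq)⟫_ℝ = 0 :=
    ha a haW
  rw [inner_sub_right, inner_smul_right, real_inner_self_eq_norm_sq, real_inner_comm] at h1
  nth_rewrite 1 [← hu] at h1
  rw [hessOp_inner hu] at h1
  have hW : ⟪x, shrink u⟫_ℝ = 0 ∧ ⟪x, u⟫_ℝ = 0 := by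
    rw [← hu] at haW
    exact ⟨mem_annihilator_iff_mul.1 haW.1, mem_annihilator_iff_sq_mul.1 haW.2⟩
  have h2 := h u
  rw [inner_shrink_comm, hW.1, hW.2] at h2
  have hμ : (μ : ℝ) < 0 := μ.2
  have h3 : (μ : ℝ) * ‖(a : RealSeq)‖ ^ 2 ≤ 0 := mul_nonpos_of_nonpos_of_nonneg hμ.le (sq_nonneg _)
  have h4 : ‖u‖ ^ 2 ≤ 0 := by nlinarith
  have h5 : u = 0 := norm_eq_zero.1 (pow_eq_zero_iff two_ne_zero |>.1 (le_antisymm h4 (sq_nonneg _)))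
  change (a : RealSeq) = 0
  rw [← hu, h5, map_zero]

theorem exists_shrink_eq {K : ℝ} (hK : ∀ n : ℕ, ((n : ℝ) + 1) ^ 4 * |amp x n| ≤ K) :
    ∃ m, shrink m = x := by
  have hmem : Memℓp (fun n : ℕ => ((n : ℝ) + 1) * x n) 2 := by
    refine memlp_two_iff.2 (Summable.of_nonneg_of_le (fun _ => sq_nonneg _) (fun n => ?_)
      (summable_inv_sq.mul_left (K ^ 2)))
    have hn : (1 : ℝ) ≤ (n : ℝ) + 1 := by linarith [n.cast_nonneg (α := ℝ)]
    rw [mul_one_div, le_div_iff₀ (by positivity), ← mul_pow, ← sq_abs]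
    refine pow_le_pow_left₀ (abs_nonneg _) ?_ 2
    rw [← mul_amp x n, abs_mul, abs_mul, abs_mul, abs_of_nonneg (by positivity : (0 : ℝ) ≤ (n : ℝ) + 1)]
    calc _ = ((n : ℝ) + 1) ^ 3 * |amp x n| := by ring
      _ ≤ ((n : ℝ) + 1) ^ 4 * |amp x n| :=
          mul_le_mul_of_nonneg_right (pow_le_pow_right₀ hn (by norm_num)) (abs_nonneg _)
      _ ≤ K := hK n
  refine ⟨⟨_, hmem⟩, ?_⟩
  ext n
  have hn : (n : ℝ) + 1 ≠ 0 := by positivity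
  change ((n : ℝ) + 1) * x n / ((n : ℝ) + 1) = x n
  field_simp

theorem numNeg_LMinus {K c C : ℝ} (hom : 0 < om) (hcrit : IsCritical om x)
    (hK : ∀ n : ℕ, ((n : ℝ) + 1) ^ 4 * |amp x n| ≤ K) (hc : 0 < c)
    (h : ∀ u, c * ‖u‖ ^ 2 ≤ hessForm (-1) om x u u +
      C * (⟪shrink x, shrink u⟫_ℝ ^ 2 + ⟪shrink x, u⟫_ℝ ^ 2)) :
    numNeg (LMinus (1 + om) om (shrink x)) = 0 := by
  rw [numNeg]
  refine cardinal_sum_eq_zero fun μ => ?_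
  suffices hbot : eigenspace (LMinus (1 + om) om (shrink x)) μ = ⊥ by
    rw [hbot]; exact rank_bot ℝ RealSeq
  rw [eq_bot_iff]
  rintro b ⟨a, ha, rfl⟩
  obtain ⟨u, hu⟩ := exists_shrink_of_mem_domain hom hK a
  have hL : hessOp (-1) (1 + om) om (shrink x) a = (μ : ℝ) • (a : RealSeq) :=
    sub_eq_zero.1 (LinearMap.mem_ker.1 ha)
  have hμ : (μ : ℝ) < 0 := μ.2
  -- Taking `w` to be the kernel elements `x` and `m` and using symmetry, `μ ≠ 0` forces the
  -- eigenvector to be orthogonal to `A` and `MA`.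
  have key : ∀ w, hessForm (-1) om x u w = μ * ⟪shrink u, shrink w⟫_ℝ := by
    intro w
    rw [← hessOp_inner hu, hL, real_inner_smul_left, hu]
  obtain ⟨m, hm⟩ := exists_shrink_eq hK
  have h1 : ⟪shrink x, shrink u⟫_ℝ = 0 := by
    have := key x
    rw [hessForm_comm, hcrit.hessForm_self, real_inner_comm] at this
    exact (mul_eq_zero.1 this.symm).resolve_left hμ.ne
  have h2 : ⟪shrink x, u⟫_ℝ = 0 := by
    have := key m
    have h3 : hessForm (-1) om x m u = 0 := by
      rw [← hm] at hcrit ⊢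
      exact hcrit.hessForm_shrink u
    rw [hessForm_comm, h3, hm, inner_shrink_comm, real_inner_comm] at this
    exact (mul_eq_zero.1 this.symm).resolve_left hμ.ne
  have h3 := h u
  rw [h1, h2, key, real_inner_self_eq_norm_sq] at h3
  have h4 : (μ : ℝ) * ‖shrink u‖ ^ 2 ≤ 0 := mul_nonpos_of_nonpos_of_nonneg hμ.le (sq_nonneg _)
  have h5 : ‖u‖ ^ 2 ≤ 0 := by nlinarith
  have h6 : u = 0 := norm_eq_zero.1 (pow_eq_zero_iff two_ne_zero |>.1 (le_antisymm h5 (sq_nonneg _)))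
  change (a : RealSeq) = 0
  rw [← hu, h6, map_zero]

end Operators

/-! ### The conserved quantities in real coordinates -/

theorem exists_amp_eq {α : ℕ → ℂ} (h : FiniteEnergy α) :
    ∃ u w : RealSeq, ∀ n, α n = ⟨amp u n, amp w n⟩ := by
  have hre : Summable fun n : ℕ => (((n : ℝ) + 1) * (α n).re) ^ 2 := by
    refine Summable.of_nonneg_of_le (fun _ => sq_nonneg _) (fun n => ?_) h
    rw [mul_pow, ← Complex.normSq_eq_norm_sq, Complex.normSq_apply]
    gcongr
    nlinarith [sq_nonneg (α n).im]
  have him : Summable fun n : ℕ => (((n : ℝ) + 1) * (α n).im) ^ 2 := by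
    refine Summable.of_nonneg_of_le (fun _ => sq_nonneg _) (fun n => ?_) h
    rw [mul_pow, ← Complex.normSq_eq_norm_sq, Complex.normSq_apply]
    gcongr
    nlinarith [sq_nonneg (α n).re]
  refine ⟨⟨_, memlp_two_iff.2 hre⟩, ⟨_, memlp_two_iff.2 him⟩, fun n => ?_⟩
  have hn : (n : ℝ) + 1 ≠ 0 := by positivity
  apply Complex.ext
  · change (α n).re = ((n : ℝ) + 1) * (α n).re / ((n : ℝ) + 1)
    field_simp
  · change (α n).im = ((n : ℝ) + 1) * (α n).im / ((n : ℝ) + 1)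
    field_simp

theorem norm_sq_mk (a b : ℝ) : ‖(⟨a, b⟩ : ℂ)‖ ^ 2 = a ^ 2 + b ^ 2 := by
  rw [← Complex.normSq_eq_norm_sq, Complex.normSq_apply]
  ring

section Coordinates

variable {α : ℕ → ℂ} {u w : RealSeq}

theorem E_eq (h : ∀ n, α n = ⟨amp u n, amp w n⟩) : E α = ‖u‖ ^ 2 + ‖w‖ ^ 2 := by
  have h1 := (hasSum_sq u).add (hasSum_sq w)
  rw [← h1.tsum_eq]
  refine tsum_congr fun n => ?_
  rw [h, norm_sq_mk, ← mul_amp u, ← mul_amp w]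
  ring

theorem Q_eq (h : ∀ n, α n = ⟨amp u n, amp w n⟩) :
    Q α = ⟪shrink u, u⟫_ℝ + ⟪shrink w, w⟫_ℝ := by
  have h1 := (hasSum_mul (shrink u) u).add (hasSum_mul (shrink w) w)
  rw [← h1.tsum_eq]
  refine tsum_congr fun n => ?_
  rw [h, norm_sq_mk, ← mul_amp u, ← mul_amp w, shrink_apply, shrink_apply]
  ring

/-- For `α = u + i w` the complex convolution of `α` with itself is `cone u u - cone w w + 2i cone u
w`, and the value is its squared norm. The imaginary part `t` only serves summability. -/
theorem hasSum_quartic_complex (h : ∀ n, α n = ⟨amp u n, amp w n⟩) :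
    ∃ t : ℝ, HasSum (fun z : ℕ × ℕ => ∑ k ∈ Finset.range (z.1 + z.2 + 1), (S z.1 z.2 k : ℂ) *
      (starRingEnd ℂ (α z.1) * starRingEnd ℂ (α z.2) * α k * α (z.1 + z.2 - k)))
      ⟨‖cone u u - cone w w‖ ^ 2 + 4 * ‖cone u w‖ ^ 2, t⟩ := by
  have hq := hasSum_quartic
  have hre := ((((hq u u u u).sub (hq u u w w)).sub (hq w w u u)).add (hq w w w w)).add
    ((((hq u w u w).add (hq u w w u)).add (hq w u u w)).add (hq w u w u))
  have him := ((((hq u u u w).add (hq u u w u)).sub (hq w w u w)).sub (hq w w w u)).add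
    ((((hq u w w w).add (hq w u w w)).sub (hq u w u u)).sub (hq w u u u))
  obtain ⟨t, ht⟩ : ∃ t : ℝ, HasSum _ t := ⟨_, him⟩
  refine ⟨t, (Complex.hasSum_iff _ _).2 ⟨?_, ?_⟩⟩
  rotate_left 1
  · convert! ht using 2 with z
    rw [Complex.im_sum]
    simp only [Finset.mul_sum, ← Finset.sum_add_distrib, ← Finset.sum_sub_distrib]
    refine Finset.sum_congr rfl fun k _ => ?_
    simp only [h, Complex.mul_im, Complex.mul_re, Complex.conj_re, Complex.conj_im,
      Complex.ofReal_re, Complex.ofReal_im]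
    ring
  · convert! hre using 2 with z
    · rw [Complex.re_sum]
      simp only [Finset.mul_sum, ← Finset.sum_add_distrib, ← Finset.sum_sub_distrib]
      refine Finset.sum_congr rfl fun k _ => ?_
      simp only [h, Complex.mul_im, Complex.mul_re, Complex.conj_re, Complex.conj_im,
        Complex.ofReal_re, Complex.ofReal_im]
      ring
    · simp only [← real_inner_self_eq_norm_sq, inner_sub_left, inner_sub_right]
      ring
    · simp only [cone_comm w u, ← real_inner_self_eq_norm_sq]
      ring

theorem H_eq (h : ∀ n, α n = ⟨amp u n, amp w n⟩) :
    H α = ‖cone u u - cone w w‖ ^ 2 + 4 * ‖cone u w‖ ^ 2 := by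
  obtain ⟨t, ht⟩ := hasSum_quartic_complex h
  rw [H, ← ht.summable.tsum_prod, ht.tsum_eq]

end Coordinates

/-! ### Rotations -/

/-- The action of the two-dimensional torus of phase rotations. -/
def rot (a b : Circle) (α : ℕ → ℂ) (n : ℕ) : ℂ := a * (b : ℂ) ^ n * α n

theorem norm_rot (a b : Circle) (α : ℕ → ℂ) (n : ℕ) : ‖rot a b α n‖ = ‖α n‖ := by
  simp [rot, Circle.norm_coe]

theorem Q_rot (a b : Circle) (α : ℕ → ℂ) : Q (rot a b α) = Q α := by
  simp only [Q, norm_rot]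

theorem E_rot (a b : Circle) (α : ℕ → ℂ) : E (rot a b α) = E α := by
  simp only [E, norm_rot]

theorem finiteEnergy_rot (a b : Circle) {α : ℕ → ℂ} (h : FiniteEnergy α) :
    FiniteEnergy (rot a b α) := by
  simpa only [FiniteEnergy, norm_rot] using h

/-- The phases cancel because the indices are resonant: `n + j = k + (n + j - k)`. -/
theorem H_rot (a b : Circle) (α : ℕ → ℂ) : H (rot a b α) = H α := by
  unfold H
  congr 1
  refine tsum_congr fun n => tsum_congr fun j => Finset.sum_congr rfl fun k hk => ?_
  have hk' : k + (n + j - k) = n + j := by simp at hk; omega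
  have ha : (starRingEnd ℂ (a : ℂ)) * a = 1 := by
    rw [mul_comm, Complex.mul_conj]; simp
  have hb : (starRingEnd ℂ (b : ℂ)) * b = 1 := by
    rw [mul_comm, Complex.mul_conj]; simp
  have hbb : (starRingEnd ℂ (b : ℂ)) ^ n * (starRingEnd ℂ (b : ℂ)) ^ j *
      ((b : ℂ) ^ k * (b : ℂ) ^ (n + j - k)) = 1 := by
    rw [← pow_add, ← pow_add, hk', ← mul_pow, hb, one_pow]
  simp only [rot, map_mul, map_pow]
  congr 1
  calc _ = ((starRingEnd ℂ (a : ℂ)) * a) ^ 2 * ((starRingEnd ℂ (b : ℂ)) ^ n *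
        (starRingEnd ℂ (b : ℂ)) ^ j * ((b : ℂ) ^ k * (b : ℂ) ^ (n + j - k))) *
        (starRingEnd ℂ (α n) * starRingEnd ℂ (α j) * α k * α (n + j - k)) := by ring
    _ = _ := by rw [ha, hbb]; ring

/-- The overlap, as a function of the rotation angle, is maximal at `0`; its derivative there is
minus the sum in question. -/
theorem tsum_mul_im_eq_zero {d : ℕ → ℂ} {m : ℕ → ℝ} (hd : Summable fun n => ‖d n‖)
    (hm : Summable fun n => |m n| * ‖d n‖)
    (hmax : ∀ t : ℝ, ∑' n, (Complex.exp ((m n * t : ℝ) * Complex.I) * d n).re ≤ ∑' n, (d n).re) :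
    ∑' n, m n * (d n).im = 0 := by
  have hform : ∀ n (t : ℝ), (Complex.exp ((m n * t : ℝ) * Complex.I) * d n).re =
      Real.cos (m n * t) * (d n).re - Real.sin (m n * t) * (d n).im := by
    intro n t
    rw [Complex.mul_re, Complex.exp_ofReal_mul_I_re, Complex.exp_ofReal_mul_I_im]
  have hder := hasDerivAt_tsum (u := fun n => 2 * (|m n| * ‖d n‖)) (hm.mul_left 2)
    (g := fun n t => Real.cos (m n * t) * (d n).re - Real.sin (m n * t) * (d n).im)
    (g' := fun n t => -Real.sin (m n * t) * (m n * 1) * (d n).re -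
      Real.cos (m n * t) * (m n * 1) * (d n).im) (y₀ := 0)
    (fun n t => by
      have h1 : HasDerivAt (fun t : ℝ => m n * t) (m n * 1) t := (hasDerivAt_id t).const_mul _
      exact (h1.cos.mul_const _).sub (h1.sin.mul_const _))
    (fun n t => by
      have h1 := Complex.abs_re_le_norm (d n)
      have h2 := Complex.abs_im_le_norm (d n)
      have h3 := Real.abs_sin_le_one (m n * t)
      have h4 := Real.abs_cos_le_one (m n * t)
      refine (norm_sub_le _ _).trans ?_
      simp only [Real.norm_eq_abs, abs_mul, abs_neg, mul_one]
      have e1 : |Real.sin (m n * t)| * |m n| * |(d n).re| ≤ 1 * |m n| * ‖d n‖ := by gcongr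
      have e2 : |Real.cos (m n * t)| * |m n| * |(d n).im| ≤ 1 * |m n| * ‖d n‖ := by gcongr
      linarith)
    (by
      refine Summable.of_norm_bounded hd fun n => ?_
      simp only [mul_zero, Real.cos_zero, Real.sin_zero, one_mul, zero_mul, sub_zero]
      exact Complex.abs_re_le_norm _) 0
  have hloc : IsLocalMax (fun t : ℝ => ∑' n, (Real.cos (m n * t) * (d n).re -
      Real.sin (m n * t) * (d n).im)) 0 := by
    refine Eventually.of_forall fun t => ?_
    have := hmax t
    simp only [hform] at this
    simpa using this
  have h0 := hloc.hasDerivAt_eq_zero hder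
  simp only [mul_zero, Real.cos_zero, Real.sin_zero, neg_zero, zero_mul, zero_sub, one_mul,
    mul_one, tsum_neg, neg_eq_zero] at h0
  exact h0

theorem rot_mul (a b a' b' : Circle) (α : ℕ → ℂ) (n : ℕ) :
    rot (a' * a) (b' * b) α n = (a' * (b' : ℂ) ^ n) * rot a b α n := by
  simp only [rot, Circle.coe_mul, mul_pow]
  ring

/-- The rotation which brings `α` closest to the real sequence `A`. -/
theorem exists_rot {α : ℕ → ℂ} {A : ℕ → ℝ} (h : Summable fun n : ℕ => ((n : ℝ) + 1) * ‖α n‖ * |A n|) :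
    ∃ a b : Circle, ∑' n, (α n).re * A n ≤ ∑' n, (rot a b α n).re * A n ∧
      ∑' n, (rot a b α n).im * A n = 0 ∧
      ∑' n : ℕ, (n : ℝ) * ((rot a b α n).im * A n) = 0 := by
  have h0 : Summable fun n : ℕ => ‖α n‖ * |A n| := by
    refine Summable.of_nonneg_of_le (fun n => by positivity) (fun n => ?_) h
    rw [mul_assoc]
    exact le_mul_of_one_le_left (by positivity) (by linarith [n.cast_nonneg (α := ℝ)])
  have h1 : Summable fun n : ℕ => (n : ℝ) * (‖α n‖ * |A n|) := by
    refine Summable.of_nonneg_of_le (fun n => by positivity) (fun n => ?_) h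
    rw [mul_assoc]
    exact mul_le_mul_of_nonneg_right (by linarith) (by positivity)
  have hcont : Continuous fun p : Circle × Circle => ∑' n, (rot p.1 p.2 α n).re * A n := by
    refine continuous_tsum (u := fun n => ‖α n‖ * |A n|) (fun n => ?_) h0 fun n p => ?_
    · unfold rot
      fun_prop
    · rw [Real.norm_eq_abs, abs_mul, ← norm_rot p.1 p.2 α n]
      exact mul_le_mul_of_nonneg_right (Complex.abs_re_le_norm _) (abs_nonneg _)
  obtain ⟨⟨a, b⟩, -, hab⟩ := isCompact_univ.exists_isMaxOn Set.univ_nonempty hcont.continuousOn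
  have hmax : ∀ a' b' : Circle, ∑' n, (rot a' b' α n).re * A n ≤ ∑' n, (rot a b α n).re * A n :=
    fun a' b' => hab (Set.mem_univ (a', b'))
  set d : ℕ → ℂ := fun n => rot a b α n * A n with hd
  have hdn : ∀ n, ‖d n‖ = ‖α n‖ * |A n| := fun n => by
    rw [hd]; simp only [norm_mul, norm_rot, Complex.norm_real, Real.norm_eq_abs]
  have hdre : ∀ n, (d n).re = (rot a b α n).re * A n := fun n => Complex.re_mul_ofReal _ _
  have hdim : ∀ n, (d n).im = (rot a b α n).im * A n := fun n => Complex.im_mul_ofReal _ _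
  refine ⟨a, b, ?_, ?_, ?_⟩
  · have := hmax 1 1
    simpa [rot] using this
  · have := tsum_mul_im_eq_zero (d := d) (m := fun _ => 1) (by simpa only [hdn] using h0)
      (by simpa only [hdn, abs_one, one_mul] using h0) (fun t => by
        have := hmax (Circle.exp t * a) (1 * b)
        simp only [rot_mul] at this
        simp only [hdre]
        convert! this using 3 with n
        rw [hd, one_mul, ← mul_assoc, Complex.re_mul_ofReal]
        simp)
    simpa only [one_mul, hdim] using this
  · have := tsum_mul_im_eq_zero (d := d) (m := fun n => n) (by simpa only [hdn] using h0)
      (by simpa only [hdn, Nat.abs_cast] using h1) (fun t => by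
        have := hmax (1 * a) (Circle.exp t * b)
        simp only [rot_mul] at this
        simp only [hdre]
        convert! this using 3 with n
        rw [hd, ← mul_assoc, Complex.re_mul_ofReal]
        simp only [Circle.coe_one, one_mul, Circle.coe_exp, ← Complex.exp_nat_mul]
        push_cast
        ring_nf)
    simpa only [hdim] using this

/-! ### Local minimality from coercivity -/

theorem abs_inner_cone_le (x y u v : RealSeq) :
    |⟪cone x y, cone u v⟫_ℝ| ≤ ‖cone‖ ^ 2 * (‖x‖ * ‖y‖ * (‖u‖ * ‖v‖)) := by
  refine (abs_real_inner_le_norm _ _).trans ?_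
  calc ‖cone x y‖ * ‖cone u v‖ ≤ (‖cone‖ * ‖x‖ * ‖y‖) * (‖cone‖ * ‖u‖ * ‖v‖) :=
        mul_le_mul (cone.le_opNorm₂ x y) (cone.le_opNorm₂ u v) (norm_nonneg _) (by positivity)
    _ = _ := by ring

/-- Exact Taylor expansion. The terms in `om` cancel and are inserted only to display the Hessian
forms; on the constraint set they also cancel the linear term. -/
theorem energy_expansion (om : ℝ) (x a b : RealSeq) :
    ‖cone (x + a) (x + a) - cone b b‖ ^ 2 + 4 * ‖cone (x + a) b‖ ^ 2 =
      ‖cone x x‖ ^ 2 + 4 * ⟪cone x x, cone x a⟫_ℝ +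
      2 * (hessForm 1 om x a a + (1 + 2 * om) * ⟪shrink a, a⟫_ℝ - om * ‖a‖ ^ 2) +
      2 * (hessForm (-1) om x b b + (1 + 2 * om) * ⟪shrink b, b⟫_ℝ - om * ‖b‖ ^ 2) +
      (4 * ⟪cone x a, cone a a⟫_ℝ - 4 * ⟪cone x a, cone b b⟫_ℝ + 8 * ⟪cone x b, cone a b⟫_ℝ) +
      (‖cone a a - cone b b‖ ^ 2 + 4 * ‖cone a b‖ ^ 2) := by
  simp only [hessForm_apply, ← real_inner_self_eq_norm_sq, map_add, _root_.add_apply, cone_comm a x,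
    inner_add_left, inner_add_right, inner_sub_left, inner_sub_right]
  rw [real_inner_comm (cone x x) (cone x a), real_inner_comm (cone x x) (cone a a),
    real_inner_comm (cone x x) (cone b b), real_inner_comm (cone x a) (cone a a),
    real_inner_comm (cone x a) (cone b b), real_inner_comm (cone x b) (cone a b)]
  ring

theorem IsCritical.exists_forall_le {om : ℝ} {x : RealSeq} (hcrit : IsCritical om x)
    (hx : ∃ m, shrink m = x)
    (hp : ∃ c > 0, ∃ C ≥ 0, ∀ u, c * ‖u‖ ^ 2 ≤ hessForm 1 om x u u +
      C * (⟪shrink x, u⟫_ℝ ^ 2 + ⟪x, u⟫_ℝ ^ 2))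
    (hm : ∃ c > 0, ∃ C ≥ 0, ∀ u, c * ‖u‖ ^ 2 ≤ hessForm (-1) om x u u +
      C * (⟪shrink x, shrink u⟫_ℝ ^ 2 + ⟪shrink x, u⟫_ℝ ^ 2)) :
    ∃ η > 0, ∀ u w : RealSeq, ‖u‖ ^ 2 + ‖w‖ ^ 2 = ‖x‖ ^ 2 →
      ⟪shrink u, u⟫_ℝ + ⟪shrink w, w⟫_ℝ = ⟪shrink x, x⟫_ℝ → ⟪shrink x, shrink w⟫_ℝ = 0 →
      ⟪shrink x, w⟫_ℝ = 0 → ‖shrink u - shrink x‖ < η →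
      ‖cone x x‖ ^ 2 ≤ ‖cone u u - cone w w‖ ^ 2 + 4 * ‖cone u w‖ ^ 2 := by
  obtain ⟨m, rfl⟩ := hx
  obtain ⟨c₁, hc₁, C, hC, hp⟩ := hp
  obtain ⟨c₂, hc₂, C', hC', hm⟩ := hm
  set x := shrink m
  -- Collects the order `d³` errors: `C / 2` from the defect in the constraints, and `8 * ‖cone‖ ^ 2
  -- * ‖x‖` as half of the `4 + 4 + 8` cubic terms.
  set K := C / 2 + 8 * ‖cone‖ ^ 2 * ‖x‖ + 1 with hK
  have hK0 : 0 < K := by positivity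
  set c := min c₁ c₂
  have hc : 0 < c := lt_min hc₁ hc₂
  set d₀ := min 1 (c / K)
  have hd₀ : 0 < d₀ := by positivity
  refine ⟨d₀ ^ 2 / (2 * ‖m‖ + 1), by positivity, fun u w hE hQ h1 h2 hη => ?_⟩
  obtain ⟨a, rfl⟩ : ∃ a, u = x + a := ⟨u - x, by abel⟩
  rw [map_add, add_sub_cancel_left] at hη
  set d := √(‖a‖ ^ 2 + ‖w‖ ^ 2)
  have hd : d ^ 2 = ‖a‖ ^ 2 + ‖w‖ ^ 2 := Real.sq_sqrt (by positivity)
  have hd0 : 0 ≤ d := Real.sqrt_nonneg _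
  have had : ‖a‖ ≤ d := Real.le_sqrt_of_sq_le (by nlinarith [sq_nonneg ‖w‖])
  have hwd : ‖w‖ ≤ d := Real.le_sqrt_of_sq_le (by nlinarith [sq_nonneg ‖a‖])
  -- Fixed `E` makes the component of `a` along `x` quadratic in `d`; fixed `Q` does the same for
  -- `shrink x`. Hence the constraint squares in `hp` cost only `d⁴`.
  have hxa : 2 * ⟪x, a⟫_ℝ = -d ^ 2 := by
    rw [norm_add_sq_real] at hE
    linarith
  have hDxa : 2 * ⟪shrink x, a⟫_ℝ = -(⟪shrink a, a⟫_ℝ + ⟪shrink w, w⟫_ℝ) := by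
    simp only [map_add, inner_add_left, inner_add_right] at hQ
    rw [inner_shrink_comm a x, real_inner_comm (shrink x) a] at hQ
    linarith
  have hself : ∀ y : RealSeq, |⟪shrink y, y⟫_ℝ| ≤ ‖y‖ ^ 2 := fun y =>
    (abs_real_inner_le_norm _ _).trans (by nlinarith [norm_shrink_le y, norm_nonneg y])
  -- Closeness in `ℓ²` gives closeness in energy: `d² = -2⟪x, a⟫ = -2⟪m, shrink a⟫`. This is where
  -- `x = shrink m` is needed.
  have hdd : d ≤ d₀ := by
    have h3 : |⟪x, a⟫_ℝ| ≤ ‖m‖ * ‖shrink a‖ := by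
      rw [show ⟪x, a⟫_ℝ = ⟪m, shrink a⟫_ℝ from inner_shrink_comm m a]
      exact abs_real_inner_le_norm _ _
    have h4 : d ^ 2 ≤ d₀ ^ 2 := by
      have h5 := (lt_div_iff₀ (by positivity)).1 hη
      have h6 := neg_abs_le ⟪x, a⟫_ℝ
      nlinarith [norm_nonneg m, norm_nonneg (shrink a)]
    exact abs_le_of_sq_le_sq' h4 hd₀.le |>.2
  have hd1 : d ≤ 1 := hdd.trans (min_le_left _ _)
  have hdK : d * K ≤ c := (le_div_iff₀ hK0).1 (hdd.trans (min_le_right _ _))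
  have hsq1 : ⟪x, a⟫_ℝ ^ 2 ≤ d ^ 4 / 4 := by
    rw [show ⟪x, a⟫_ℝ = -d ^ 2 / 2 by linarith]
    exact le_of_eq (by ring)
  have hsq2 : ⟪shrink x, a⟫_ℝ ^ 2 ≤ d ^ 4 / 4 := by
    have h3 : |⟪shrink x, a⟫_ℝ| ≤ d ^ 2 / 2 := by
      rw [show ⟪shrink x, a⟫_ℝ = -(⟪shrink a, a⟫_ℝ + ⟪shrink w, w⟫_ℝ) / 2 by linarith, abs_div,
        abs_neg, abs_two]
      have := abs_add_le ⟪shrink a, a⟫_ℝ ⟪shrink w, w⟫_ℝ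
      linarith [hself a, hself w]
    rw [show d ^ 4 / 4 = (d ^ 2 / 2) ^ 2 by ring]
    exact sq_le_sq' (by linarith [neg_abs_le ⟪shrink x, a⟫_ℝ]) ((le_abs_self _).trans h3)
  have hpa : c * ‖a‖ ^ 2 ≤ hessForm 1 om x a a + C * (d ^ 4 / 2) := by
    refine (mul_le_mul_of_nonneg_right (min_le_left _ _) (by positivity)).trans ((hp a).trans ?_)
    gcongr
    linarith
  have hmw : c * ‖w‖ ^ 2 ≤ hessForm (-1) om x w w := by
    refine (mul_le_mul_of_nonneg_right (min_le_right _ _) (by positivity)).trans ((hm w).trans ?_)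
    rw [h1, h2]
    simp
  have hcube : ∀ {p q r s : RealSeq}, p = x → ‖q‖ ≤ d → ‖r‖ ≤ d → ‖s‖ ≤ d →
      |⟪cone p q, cone r s⟫_ℝ| ≤ ‖cone‖ ^ 2 * ‖x‖ * d ^ 3 := by
    intro p q r s hp hq hr hs
    rw [hp]
    refine (abs_inner_cone_le _ _ _ _).trans ?_
    calc _ ≤ ‖cone‖ ^ 2 * (‖x‖ * d * (d * d)) := by gcongr
      _ = _ := by ring
  have e1 := (abs_le.1 (hcube rfl had had had)).1
  have e2 : ⟪cone x a, cone w w⟫_ℝ ≤ _ := (abs_le.1 (hcube rfl had hwd hwd)).2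
  have e3 := (abs_le.1 (hcube rfl hwd had hwd)).1
  rw [energy_expansion om, hcrit a]
  have e4 : C * (d ^ 4 / 2) ≤ C / 2 * d ^ 3 := by
    have : d ^ 4 ≤ d ^ 3 := pow_le_pow_of_le_one hd0 hd1 (by norm_num)
    linarith [mul_le_mul_of_nonneg_left this hC]
  have e5 : d ^ 2 * (d * K) ≤ d ^ 2 * c := mul_le_mul_of_nonneg_left hdK (sq_nonneg _)
  have e6 : 0 ≤ d ^ 3 := by positivity
  have e7 : 0 ≤ ‖cone a a - cone w w‖ ^ 2 + 4 * ‖cone a w‖ ^ 2 := by positivity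
  have e8 : (1 + 2 * om) * (2 * ⟪shrink x, a⟫_ℝ) - om * (2 * ⟪x, a⟫_ℝ) =
      -(1 + 2 * om) * (⟪shrink a, a⟫_ℝ + ⟪shrink w, w⟫_ℝ) + om * (‖a‖ ^ 2 + ‖w‖ ^ 2) := by
    rw [hxa, hDxa, hd]; ring
  rw [hK] at e5
  rw [hd] at e5
  have e9 : (‖a‖ ^ 2 + ‖w‖ ^ 2) * d = d ^ 3 := by rw [← hd]; ring
  have e10 : (‖a‖ ^ 2 + ‖w‖ ^ 2) * (d * (C / 2 + 8 * ‖cone‖ ^ 2 * ‖x‖ + 1)) =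
      C / 2 * d ^ 3 + 8 * (‖cone‖ ^ 2 * ‖x‖ * d ^ 3) + d ^ 3 := by rw [← e9]; ring
  linarith

/-! ### Phase alignment and the conclusion -/

theorem hasSum_norm_sq (α : ComplexSeq) : HasSum (fun n => ‖α n‖ ^ 2) (‖α‖ ^ 2) := by
  have := lp.hasSum_norm (p := 2) (by norm_num) α
  simpa using this

theorem norm_sq_sub_ofReal (z : ℂ) (t : ℝ) :
    ‖z - t‖ ^ 2 = ‖z‖ ^ 2 - 2 * (z.re * t) + t ^ 2 := by
  simp only [← Complex.normSq_eq_norm_sq, Complex.normSq_apply, Complex.sub_re, Complex.sub_im,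
    Complex.ofReal_re, Complex.ofReal_im]
  ring

theorem tsum_re_mul (α : ComplexSeq) (A : RealSeq) :
    2 * ∑' n, (α n).re * A n = ‖α‖ ^ 2 + ‖A‖ ^ 2 - ‖α - toComplex A‖ ^ 2 := by
  have h := ((hasSum_norm_sq α).add (hasSum_sq A)).sub (hasSum_norm_sq (α - toComplex A))
  rw [← h.tsum_eq, ← tsum_mul_left]
  refine tsum_congr fun n => ?_
  have h1 : (α - toComplex A) n = α n - (A n : ℝ) := rfl
  rw [h1, norm_sq_sub_ofReal]
  ring

/-- Every sequence of finite energy can be rotated so as to meet the orthogonality conditions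
at `shrink x`, without moving away from it. -/
theorem exists_rot_amp (x : RealSeq) (α : ComplexSeq) (hF : FiniteEnergy α) :
    ∃ (a b : Circle) (u w : RealSeq), (∀ n, rot a b α n = ⟨amp u n, amp w n⟩) ∧
      ⟪shrink x, shrink w⟫_ℝ = 0 ∧ ⟪shrink x, w⟫_ℝ = 0 ∧
      ‖shrink u - shrink x‖ ≤ ‖α - toComplex (shrink x)‖ := by
  have hsum : Summable fun n : ℕ => ((n : ℝ) + 1) * ‖α n‖ * |shrink x n| := by
    refine Summable.of_nonneg_of_le (fun n => by positivity) (fun n => ?_)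
      (Summable.add hF (hasSum_sq (shrink x)).summable)
    have := two_mul_le_add_sq (((n : ℝ) + 1) * ‖α n‖) |shrink x n|
    have h0 : 0 ≤ ((n : ℝ) + 1) * ‖α n‖ * |shrink x n| := by positivity
    rw [sq_abs] at this
    linarith
  obtain ⟨a, b, hclose, h0, h1⟩ := exists_rot hsum
  obtain ⟨u, w, huw⟩ := exists_amp_eq (finiteEnergy_rot a b hF)
  have hw := hasSum_mul (shrink x) (shrink w)
  have e0 : ⟪shrink x, shrink w⟫_ℝ = 0 := by
    rw [← hw.tsum_eq, ← h0]
    refine tsum_congr fun n => ?_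
    rw [huw, shrink_apply w, mul_comm]
  refine ⟨a, b, u, w, huw, e0, ?_, ?_⟩
  · have h2 := (hasSum_mul (shrink x) w).sub hw
    rw [e0, sub_zero] at h2
    rw [← h2.tsum_eq, ← h1]
    refine tsum_congr fun n => ?_
    rw [huw, ← mul_amp w, shrink_apply w]
    ring
  · have h2 : ∑' n, (rot a b α n).re * shrink x n = ⟪shrink u, shrink x⟫_ℝ := by
      rw [← (hasSum_mul (shrink u) (shrink x)).tsum_eq]
      refine tsum_congr fun n => ?_
      rw [huw, shrink_apply u]
    have h3 : ‖shrink u‖ ^ 2 ≤ ‖α‖ ^ 2 := by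
      refine hasSum_le (fun n => ?_) (hasSum_sq (shrink u)) (hasSum_norm_sq α)
      rw [← norm_rot a b α n, huw, norm_sq_mk, shrink_apply]
      linarith [sq_nonneg (amp w n)]
    refine abs_le_of_sq_le_sq' ?_ (norm_nonneg _) |>.2
    rw [norm_sub_sq_real]
    linarith [tsum_re_mul α (shrink x)]

theorem IsCritical.isConstrainedLocalMin {om : ℝ} {x : RealSeq} (hcrit : IsCritical om x)
    (hx : ∃ m, shrink m = x)
    (hp : ∃ c > 0, ∃ C ≥ 0, ∀ u, c * ‖u‖ ^ 2 ≤ hessForm 1 om x u u +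
      C * (⟪shrink x, u⟫_ℝ ^ 2 + ⟪x, u⟫_ℝ ^ 2))
    (hm : ∃ c > 0, ∃ C ≥ 0, ∀ u, c * ‖u‖ ^ 2 ≤ hessForm (-1) om x u u +
      C * (⟪shrink x, shrink u⟫_ℝ ^ 2 + ⟪shrink x, u⟫_ℝ ^ 2)) :
    IsConstrainedLocalMin (shrink x) := by
  obtain ⟨η, hη, hmin⟩ := hcrit.exists_forall_le hx hp hm
  have hA : ∀ n, toComplex (shrink x) n = ⟨amp x n, amp 0 n⟩ := by
    intro n
    apply Complex.ext
    · rfl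
    · simp [toComplex, amp]
  filter_upwards [self_mem_nhdsWithin,
    mem_nhdsWithin_of_mem_nhds (Metric.ball_mem_nhds _ hη)] with α hα hball
  obtain ⟨hF, hQ, hE⟩ := hα
  obtain ⟨a, b, u, w, huw, h1, h2, h3⟩ := exists_rot_amp x α hF
  rw [← Q_rot a b, Q_eq huw, Q_eq hA] at hQ
  rw [← E_rot a b, E_eq huw, E_eq hA] at hE
  rw [← H_rot a b α, H_eq huw, H_eq hA]
  have := hmin u w (by simpa using hE) (by simpa using hQ) h1 h2
    (h3.trans_lt (by rwa [mem_ball_iff_norm] at hball))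
  simpa using this

theorem IsBifurcation.isMinimizingBranch {om₀ r : ℝ} {v : RealSeq} {om : ℝ → ℝ}
    {A : ℝ → RealSeq} (hb : IsBifurcation om₀ v) (h : IsBranch om₀ (amp v) r om A) :
    IsMinimizingBranch om A := by
  obtain ⟨x, hev, hom, hx⟩ := h.exists_lift hb
  have hall : ∀ᶠ ε in 𝓝[≠] (0 : ℝ), IsConstrainedLocalMin (A ε) ∧
      numNegConstrained (LPlus (1 + om ε) (om ε) (A ε)) (constrainedSpace (A ε)) = 0 ∧
      numNeg (LMinus (1 + om ε) (om ε) (A ε)) = 0 := by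
    filter_upwards [hev, hb.eventually_plus hom hx, hb.eventually_minus hom hx,
      hom.eventually (lt_mem_nhds hb.om_pos)] with ε h1 hp hm hpos
    obtain ⟨hA, hcrit, K, hK⟩ := h1
    rw [← hA]
    refine ⟨hcrit.isConstrainedLocalMin (exists_shrink_eq hK) hp hm, ?_, ?_⟩
    · obtain ⟨c, hc, C, hC, hp⟩ := hp
      exact numNegConstrained_LPlus hpos hK hc hp
    · obtain ⟨c, hc, C, hC, hm⟩ := hm
      exact numNeg_LMinus hpos hcrit hK hc hm
  obtain ⟨ε₀, hε₀, hball⟩ := Metric.mem_nhdsWithin_iff.1 hall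
  refine ⟨ε₀, hε₀, fun ε h0 hlt => hball ⟨?_, abs_pos.1 h0⟩⟩
  rwa [mem_ball_zero_iff, Real.norm_eq_abs]

end ConformalFlow

end

theorem mainTheorem8 :
    ((∃ (r : ℝ) (om : ℝ → ℝ) (A : ℝ → ConformalFlow.RealSeq),
        ConformalFlow.IsBranch (2 / 3)
          (3 • ConformalFlow.unitSeq 0 - ConformalFlow.unitSeq 2) r om A) ∧
      ∀ (r : ℝ) (om : ℝ → ℝ) (A : ℝ → ConformalFlow.RealSeq),
        ConformalFlow.IsBranch (2 / 3)
          (3 • ConformalFlow.unitSeq 0 - ConformalFlow.unitSeq 2) r om A →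
        ConformalFlow.IsMinimizingBranch om A) ∧
    ((∃ (r : ℝ) (om : ℝ → ℝ) (A : ℝ → ConformalFlow.RealSeq),
        ConformalFlow.IsBranch (3 / 35) (ConformalFlow.unitSeq 6) r om A) ∧
      ∀ (r : ℝ) (om : ℝ → ℝ) (A : ℝ → ConformalFlow.RealSeq),
        ConformalFlow.IsBranch (3 / 35) (ConformalFlow.unitSeq 6) r om A →
        ConformalFlow.IsMinimizingBranch om A) := by
  rw [← ConformalFlow.amp_two, ← ConformalFlow.amp_mode 6]
  exact ⟨⟨ConformalFlow.exists_isBranch ConformalFlow.isBifurcation_two,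
    fun _ _ _ h => ConformalFlow.isBifurcation_two.isMinimizingBranch h⟩,
    ConformalFlow.exists_isBranch ConformalFlow.isBifurcation_six,
    fun _ _ _ h => ConformalFlow.isBifurcation_six.isMinimizingBranch h⟩
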